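/- Let $n\ge 1$. A (smooth) solid cone in $\mathbb{R}^{n+1}$ is a set $M=\{tp : t\ge 0,\ p\in\mathcal D\}$, where $\mathcal D$ is a smooth region of the unit sphere $\mathbb{S}^n$ (a nonempty connected open subset of $\mathbb{S}^n$ together with its possibly empty $C^\infty$ boundary). Let $\partial M$ and $\operatorname{int}(M)$ be its topological boundary and interior, and put $M^*=M\setminus\{0\}$. Let $k\in\mathbb{R}$ and let $f=e^{\psi}$ be a $k$-homogeneous density on $M$, that is, a positive $C^\infty$ function on $M^*$ with $f(tp)=t^k f(p)$ for all $t>0$ and $p\in M^*$. Let $\Sigma$ be a smooth, compact, orientable hypersurface, with possibly empty boundary, immersed in $M^*$, such that $\partial\Sigma\subset\partial M$ and $\Sigma$ meets $\partial M$ orthogonally at the points of $\partial\Sigma$. Let $N$ be a smooth unit normal along $\Sigma$ and $X(p)=p$ the position vector field. Write $da_f=f\,da$, where $da$ is the Riemannian area element of $\Sigma$, and let $$H_f=-\operatorname{div}_\Sigma N-\langle\nabla\psi,N\rangle$$ be the $f$-mean curvature of $\Sigma$ with respect to $N$. Then $da_f$ is a finite measure on $\Sigma$, the function $n+k+H_f\langle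 X,N\rangle$ is integrable, and $$\int_\Sigma\big(n+k+H_f\langle X,N\rangle\big)\,da_f=0.$$ If, in addition, $k\neq-(n+1)$ and $H_f$ is constant along $\Sigma$, then $$(n+k)\,A_f(\Sigma)=(n+k+1)\,H_f\,V_f(\Sigma),$$ where $A_f(\Sigma)=\int_{\Sigma\cap\operatorname{int}(M)}da_f$ is the weighted area of $\Sigma$ relative to the interior of $M$, and $V_f(\Sigma)=\frac{-1}{n+k+1}\int_\Sigma\langle X,N\rangle\,da_f$ is the oriented weighted volume. -/

import Mathlib

open Set MeasureTheory
open scoped Manifold ContDiff RealInnerProductSpace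

noncomputable section

namespace SolidCone

/-- Euclidean space of dimension `n + 1`. -/
abbrev E (n : ℕ) : Type := EuclideanSpace ℝ (Fin (n + 1))

/-! ### Solid cones and homogeneous densities -/

/-- `D` is a smooth region of the unit sphere `Sⁿ`: the union (closure) of a nonempty connected
relatively open set `U` of the sphere and its smooth boundary. Smoothness of the boundary: near each
boundary point `p`, `U` is the sublevel set `{g < 0}` in the sphere of a smooth function `g` whose
differential at `p` does not vanish on the tangent space `p^⊥` of the sphere. -/
def IsSmoothSphericalRegion {n : ℕ} (D : Set (E n)) : Prop :=
  ∃ U : Set (E n),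
    (∃ O : Set (E n), IsOpen O ∧ U = Metric.sphere (0 : E n) 1 ∩ O) ∧
    IsConnected U ∧
    D = closure U ∧
    ∀ p ∈ closure U \ U, ∃ (W : Set (E n)) (g : E n → ℝ),
      IsOpen W ∧ p ∈ W ∧ ContDiff ℝ ∞ g ∧
      (∃ v : E n, ⟪p, v⟫ = 0 ∧ fderiv ℝ g p v ≠ 0) ∧
      U ∩ W = {q | q ∈ Metric.sphere (0 : E n) 1 ∧ q ∈ W ∧ g q < 0}

/-- The cone `{t p ; t ≥ 0, p ∈ D}` with vertex at the origin. -/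
def coneOver {n : ℕ} (D : Set (E n)) : Set (E n) :=
  {x | ∃ t : ℝ, 0 ≤ t ∧ ∃ p ∈ D, x = t • p}

/-- Smooth solid cones: cones over smooth regions of the unit sphere. -/
def IsSolidCone {n : ℕ} (M : Set (E n)) : Prop :=
  ∃ D : Set (E n), IsSmoothSphericalRegion D ∧ M = coneOver D

/-- The punctured cone `M*`. -/
def punctured {n : ℕ} (M : Set (E n)) : Set (E n) := M \ {0}

/-- `f` is a smooth homogeneous density of degree `k` on `M`: smooth (up to the boundary) and positive
on `M*`, with `f (t p) = t ^ k f p`. Values of `f` outside `M*` are irrelevant. -/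
structure IsHomogeneousDensity {n : ℕ} (M : Set (E n)) (k : ℝ) (f : E n → ℝ) : Prop where
  smooth : ContDiffOn ℝ ∞ f (punctured M)
  pos : ∀ p ∈ punctured M, 0 < f p
  homogeneous : ∀ t : ℝ, 0 < t → ∀ p ∈ punctured M, f (t • p) = t ^ k * f p

/-- The gradient of `ψ = log f` on the manifold with boundary `M*`. -/
def gradLog {n : ℕ} (M : Set (E n)) (f : E n → ℝ) (q : E n) : E n :=
  gradientWithin (fun x => Real.log (f x)) (punctured M) q

/-- Vectors normal to a subset `Z` of Euclidean space at `q`: those orthogonal to every tangent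
vector. -/
def normalSpace {n : ℕ} (Z : Set (E n)) (q : E n) : Set (E n) :=
  {ξ | ∀ v ∈ tangentConeAt ℝ Z q, ⟪ξ, v⟫ = 0}

/-! ### Immersed hypersurfaces

`S` is an `n`-dimensional smooth manifold with (possibly empty) boundary, and `φ : S → ℝⁿ⁺¹`. -/

section Hypersurface

variable {n : ℕ} [NeZero n] {S : Type*} [TopologicalSpace S] [ChartedSpace (EuclideanHalfSpace n) S]

/-- The derivative of a map `V : S → ℝⁿ⁺¹` at `p` along the `i`-th coordinate vector of `T_p S`. -/
def partialDeriv (V : S → E n) (p : S) (i : Fin n) : E n :=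
  mfderiv (𝓡∂ n) 𝓘(ℝ, E n) V p (EuclideanSpace.single i (1 : ℝ) : EuclideanSpace ℝ (Fin n))

/-- `φ` is a smooth immersion. -/
def IsSmoothImmersion (φ : S → E n) : Prop :=
  ContMDiff (𝓡∂ n) 𝓘(ℝ, E n) ∞ φ ∧
    ∀ p : S, Function.Injective (mfderiv (𝓡∂ n) 𝓘(ℝ, E n) φ p)

/-- `N` is a (smooth) unit normal along the immersion `φ`. -/
structure IsUnitNormal (φ N : S → E n) : Prop where
  smooth : ContMDiff (𝓡∂ n) 𝓘(ℝ, E n) ∞ N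
  norm_eq_one : ∀ p : S, ‖N p‖ = 1
  orthogonal : ∀ (p : S) (i : Fin n), ⟪partialDeriv φ p i, N p⟫ = 0

/-- The divergence relative to the hypersurface of a vector field `V` along `φ`, i.e.
`∑ ⟪D_{e_i} V, e_i⟫` over an orthonormal basis `e_i` of the tangent space `dφ (T_p S)`; in terms of
the coordinate basis of `T_p S` this is `∑ g^{ij} ⟪∂_i V, ∂_j φ⟫` with `g_{ij} = ⟪∂_i φ, ∂_j φ⟫`. -/
def surfaceDiv (φ V : S → E n) (p : S) : ℝ :=
  Matrix.trace ((Matrix.of fun i j => ⟪partialDeriv φ p i, partialDeriv φ p j⟫)⁻¹ *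
    (Matrix.of fun i j => ⟪partialDeriv V p i, partialDeriv φ p j⟫))

/-- The `f`-mean curvature `H_f = -div_Σ N - ⟪∇ψ, N⟫`, where `ψ = log f`. -/
def meanCurvature (M : Set (E n)) (f : E n → ℝ) (φ N : S → E n) (p : S) : ℝ :=
  -surfaceDiv φ N p - ⟪gradLog M f (φ p), N p⟫

/-- The area density `√(det g)` of `φ` in the preferred chart at `x`, as a function on the
coordinate domain. -/
def chartAreaDensity (φ : S → E n) (x : S) (u : EuclideanSpace ℝ (Fin n)) : ℝ :=
  Real.sqrt (Matrix.det (Matrix.of fun i j : Fin n =>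
    ⟪fderivWithin ℝ (φ ∘ (extChartAt (𝓡∂ n) x).symm) (range (𝓡∂ n)) u (EuclideanSpace.single i 1),
     fderivWithin ℝ (φ ∘ (extChartAt (𝓡∂ n) x).symm) (range (𝓡∂ n)) u
        (EuclideanSpace.single j 1)⟫))

variable [MeasurableSpace S]

/-- The area measure of `φ` on the domain of the preferred chart at `x`, extended by zero. -/
def chartArea (φ : S → E n) (x : S) : Measure S :=
  Measure.map (extChartAt (𝓡∂ n) x).symm
    ((volume.restrict (extChartAt (𝓡∂ n) x).target).withDensity
      fun u => ENNReal.ofReal (chartAreaDensity φ x u))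

/-- The Riemannian area measure `da` on `S` of the metric induced by `φ`. The local measures
`√(det g) du` agree on overlaps of charts, and their supremum in the lattice of measures is the
measure obtained by gluing them. -/
def area (φ : S → E n) : Measure S := ⨆ x : S, chartArea φ x

/-- The weighted area measure `da_f = f da`. -/
def weightedAreaMeasure (f : E n → ℝ) (φ : S → E n) : Measure S :=
  (area φ).withDensity fun p => ENNReal.ofReal (f (φ p))

/-- The weighted area `A_f(Σ)` relative to the interior of the cone. -/
def weightedArea (M : Set (E n)) (f : E n → ℝ) (φ : S → E n) : ℝ :=
  (weightedAreaMeasure f φ).real (φ ⁻¹' interior M)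

/-- The oriented weighted volume `V_f(Σ) = -1/(n+k+1) ∫_Σ ⟪X, N⟫ da_f`, with `X` the position
vector. -/
def orientedVolume (k : ℝ) (f : E n → ℝ) (φ N : S → E n) : ℝ :=
  -1 / ((n : ℝ) + k + 1) * ∫ p, ⟪φ p, N p⟫ ∂(weightedAreaMeasure f φ)

end Hypersurface

end SolidCone

end

noncomputable section

namespace SolidCone

/-! The integral identity is the divergence theorem for the tangential part X^T = X - ⟨X,N⟩N of the
position field. Since div_Σ X = n and, by Euler's identity for a k-homogeneous density, ⟨∇ψ,X⟩ = k,
the weighted divergence of X^T is n + k + H_f⟨X,N⟩. The boundary flux vanishes: along ∂Σ both X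
(because M is a cone) and N (because of orthogonality) are tangent to ∂M, so X^T has no component
along the conormal, which is normal to ∂M.

The integration is carried out in charts with a partition of unity. By Cramer's rule the i-th
component of √(det g) X^T is, up to a locally constant sign, the determinant of (N, ∂₁φ, …, ∂ₙφ)
with X in place of ∂ᵢφ. In its divergence the second derivatives of φ cancel by symmetry
(`sum_alternating_derivative`). The density and the cutoff enter in `coordDiv_testField`, the flux
in `tangential_position_boundary`, the half-space divergence theorem is `integral_coordDiv_eq_zero`,
and `area_restrict_source` identifies the area measure with its coordinate expressions.

For constant H the identity reads (n+k)A + H∫⟨X,N⟩ = 0, where A is the weighted area of all of Σ,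
whereas the claim counts only the part in int(M). If H = 0, then (n+k)A = 0 and the difference is
immaterial. If H ≠ 0, the set where Σ touches ∂M is null (`area_contact_eq_zero`). Indeed a
differentiable function has zero derivative at almost every point of its zero set
(`ae_fderiv_eq_zero`). Applied to a defining function of ∂M this shows that N agrees with the unit
normal of ∂M up to sign almost everywhere on the contact set. Applied to the difference of the
normals it shows that the shape operators agree, so the weighted curvature of ∂M equals H up to
sign. Applied once more, it makes that curvature stationary in the direction X; being homogeneous of
degree -1 it must vanish, which contradicts H ≠ 0. -/

/-- The coordinate space of an `n`-dimensional hypersurface. -/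
abbrev Coord (n : ℕ) : Type := EuclideanSpace ℝ (Fin n)

/-- The `i`-th coordinate vector. -/
abbrev coordVec {n : ℕ} (i : Fin n) : Coord n := EuclideanSpace.single i 1

/-! ### Linear algebra of a hyperplane with a unit normal -/

section LinearAlgebra

variable {n : ℕ}

lemma sum_smul_coordVec (v : Coord n) : ∑ i, v i • coordVec i = v := by
  simpa using (EuclideanSpace.basisFun (Fin n) ℝ).sum_repr v

lemma map_eq_sum_coordVec {F : Type*} [AddCommGroup F] [Module ℝ F] [TopologicalSpace F]
    (L : Coord n →L[ℝ] F) (v : Coord n) : L v = ∑ i, v i • L (coordVec i) := by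
  conv_lhs => rw [← sum_smul_coordVec v]
  simp

/-- The Gram matrix of a linear map. -/
def gramMatrix (L : Coord n →L[ℝ] E n) : Matrix (Fin n) (Fin n) ℝ :=
  Matrix.of fun i j => ⟪L (coordVec i), L (coordVec j)⟫

/-- The divergence of `B` relative to `L`. -/
def gramDiv (L B : Coord n →L[ℝ] E n) : ℝ :=
  Matrix.trace ((gramMatrix L)⁻¹ * (Matrix.of fun i j => ⟪B (coordVec i), L (coordVec j)⟫))

lemma trace_eq_sum_coordVec (C : Coord n →L[ℝ] Coord n) :
    LinearMap.trace ℝ (Coord n) C = ∑ i, C (coordVec i) i := by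
  rw [LinearMap.trace_eq_matrix_trace ℝ (EuclideanSpace.basisFun (Fin n) ℝ).toBasis]
  simp [Matrix.trace, LinearMap.toMatrix_apply]

lemma isUnit_det_gramMatrix {L : Coord n →L[ℝ] E n} (hL : Function.Injective L) :
    IsUnit (gramMatrix L).det := by
  have h : LinearIndependent ℝ (fun i => L (coordVec i)) := by
    have := (EuclideanSpace.basisFun (Fin n) ℝ).toBasis.linearIndependent.map' (L : Coord n →ₗ[ℝ] E n)
      (LinearMap.ker_eq_bot.2 hL)
    have h3 : ⇑(L : Coord n →ₗ[ℝ] E n) ∘ ⇑(EuclideanSpace.basisFun (Fin n) ℝ).toBasis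
        = fun i => L (coordVec i) := by
      ext1 i
      simp
    rwa [h3] at this
  have h2 := Matrix.det_gram_ne_zero_iff_linearIndependent (𝕜 := ℝ).2 h
  exact isUnit_iff_ne_zero.2 h2

/-- The matrix of inner products factors as the matrix of `C` times the Gram matrix, which cancels
against its inverse under the cyclic trace. -/
lemma gramDiv_comp_right {L : Coord n →L[ℝ] E n} (hL : Function.Injective L)
    (C : Coord n →L[ℝ] Coord n) : gramDiv L (L.comp C) = LinearMap.trace ℝ (Coord n) C := by
  have hb : (Matrix.of fun i j => ⟪(L.comp C) (coordVec i), L (coordVec j)⟫)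
      = (Matrix.of fun i k => C (coordVec i) k) * gramMatrix L := by
    ext i j
    simp only [Matrix.of_apply, Matrix.mul_apply, gramMatrix, ContinuousLinearMap.comp_apply]
    rw [map_eq_sum_coordVec L (C (coordVec i)), sum_inner]
    simp [real_inner_smul_left]
  rw [gramDiv, hb, Matrix.trace_mul_comm, Matrix.mul_assoc,
    Matrix.mul_nonsing_inv _ (isUnit_det_gramMatrix hL), Matrix.mul_one, trace_eq_sum_coordVec]
  simp [Matrix.trace]

/-- A left inverse of `L` that kills the unit normal. -/
lemma exists_tangential_leftInverse {L : Coord n →L[ℝ] E n} (hL : Function.Injective L) {ν : E n}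
    (hν : ‖ν‖ = 1) (hLν : ∀ v, ⟪L v, ν⟫ = 0) :
    ∃ P : E n →L[ℝ] Coord n, ∀ y, L (P y) = y - ⟪y, ν⟫ • ν := by
  have hνν : ⟪ν, ν⟫ = 1 := by rw [real_inner_self_eq_norm_sq, hν]; norm_num
  -- `(v, t) ↦ L v + t ν` is injective between spaces of dimension n + 1, hence invertible; `P` is
  -- the first component of its inverse.
  let Ψ : (Coord n × ℝ) →ₗ[ℝ] E n :=
    (L : Coord n →ₗ[ℝ] E n).coprod (LinearMap.toSpanSingleton ℝ (E n) ν)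
  have hΨ : ∀ v t, Ψ (v, t) = L v + t • ν := fun v t => by simp [Ψ]
  have hin : ∀ v t, ⟪Ψ (v, t), ν⟫ = t := fun v t => by
    rw [hΨ, inner_add_left, hLν, real_inner_smul_left, hνν]; ring
  have hinj : Function.Injective Ψ := by
    rw [← LinearMap.ker_eq_bot, LinearMap.ker_eq_bot']
    rintro ⟨v, t⟩ h
    have ht : t = 0 := by rw [← hin v t, h, inner_zero_left]
    subst ht
    have hv : L v = 0 := by simpa [hΨ] using h
    have : v = 0 := hL (by rw [hv, map_zero])
    rw [this]; rfl
  let e : (Coord n × ℝ) ≃ₗ[ℝ] E n := LinearEquiv.ofInjectiveOfFinrankEq Ψ hinj (by simp)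
  have he : ∀ z, e z = Ψ z := fun z => rfl
  refine ⟨LinearMap.toContinuousLinearMap ((LinearMap.fst ℝ (Coord n) ℝ).comp e.symm.toLinearMap),
    fun y => ?_⟩
  obtain ⟨⟨v, t⟩, rfl⟩ := e.surjective y
  have : (LinearMap.toContinuousLinearMap
      ((LinearMap.fst ℝ (Coord n) ℝ).comp e.symm.toLinearMap)) (e (v, t)) = v := by simp
  rw [this, he, hin, hΨ, add_sub_cancel_right]

lemma eq_comp_of_tangential {L B : Coord n →L[ℝ] E n} {ν : E n} {P : E n →L[ℝ] Coord n}
    (hP : ∀ y, L (P y) = y - ⟪y, ν⟫ • ν) (hB : ∀ v, ⟪B v, ν⟫ = 0) : B = L.comp (P.comp B) := by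
  ext1 v
  simp [hP, hB]

lemma gramDiv_eq_trace {L B : Coord n →L[ℝ] E n} (hL : Function.Injective L) {ν : E n}
    {P : E n →L[ℝ] Coord n}
    (hP : ∀ y, L (P y) = y - ⟪y, ν⟫ • ν) (hB : ∀ v, ⟪B v, ν⟫ = 0) :
    gramDiv L B = LinearMap.trace ℝ (Coord n) (P.comp B : Coord n →L[ℝ] Coord n) := by
  conv_lhs => rw [eq_comp_of_tangential hP hB]
  exact gramDiv_comp_right hL _

/-- The relative divergence does not depend on the coordinates. -/
lemma gramDiv_comp_equiv {L B : Coord n →L[ℝ] E n} (hL : Function.Injective L) {ν : E n}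
    (hν : ‖ν‖ = 1) (hLν : ∀ v, ⟪L v, ν⟫ = 0) (hB : ∀ v, ⟪B v, ν⟫ = 0)
    (A : Coord n ≃L[ℝ] Coord n) :
    gramDiv (L.comp (A : Coord n →L[ℝ] Coord n)) (B.comp (A : Coord n →L[ℝ] Coord n))
      = gramDiv L B := by
  obtain ⟨P, hP⟩ := exists_tangential_leftInverse hL hν hLν
  rw [gramDiv_eq_trace hL hP hB]
  have hLA : Function.Injective (L.comp (A : Coord n →L[ℝ] Coord n)) := hL.comp A.injective
  have hP' : ∀ y, (L.comp (A : Coord n →L[ℝ] Coord n))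
      (((A.symm : Coord n →L[ℝ] Coord n).comp P) y) = y - ⟪y, ν⟫ • ν := fun y => by simp [hP]
  rw [gramDiv_eq_trace (B := B.comp (A : Coord n →L[ℝ] Coord n)) hLA hP' (fun v => hB _)]
  -- With left inverse `A⁻¹ P` for `L A`, the endomorphism whose trace is taken is conjugated by
  -- `A`.
  rw [← LinearMap.trace_conj' (P.comp B : Coord n →L[ℝ] Coord n).toLinearMap
    A.symm.toLinearEquiv]
  congr 1

/-- The trace of an endomorphism in terms of a hyperplane and its unit normal. -/
lemma trace_eq_trace_tangential {L : Coord n →L[ℝ] E n} {ν : E n} {P : E n →L[ℝ] Coord n}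
    (hP : ∀ y, L (P y) = y - ⟪y, ν⟫ • ν) (A : E n →L[ℝ] E n) (hA : ⟪A ν, ν⟫ = 0) :
    LinearMap.trace ℝ (Coord n) (P.comp (A.comp L) : Coord n →L[ℝ] Coord n)
      = LinearMap.trace ℝ (E n) A := by
  have h1 : LinearMap.trace ℝ (Coord n) (P.comp (A.comp L) : Coord n →L[ℝ] Coord n)
      = LinearMap.trace ℝ (E n) ((A : E n →ₗ[ℝ] E n) ∘ₗ ((L : Coord n →ₗ[ℝ] E n) ∘ₗ
        (P : E n →ₗ[ℝ] Coord n))) := by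
    rw [← LinearMap.comp_assoc]
    exact LinearMap.trace_comp_comm' ((A : E n →ₗ[ℝ] E n) ∘ₗ (L : Coord n →ₗ[ℝ] E n))
      (P : E n →ₗ[ℝ] Coord n)
  -- `L P` is the orthogonal projection off `ν`, so `A L P` differs from `A` by a rank-one map of
  -- trace `⟪A ν, ν⟫ = 0`.
  have h2 : (A : E n →ₗ[ℝ] E n) ∘ₗ ((L : Coord n →ₗ[ℝ] E n) ∘ₗ (P : E n →ₗ[ℝ] Coord n))
      = (A : E n →ₗ[ℝ] E n) - LinearMap.smulRight (innerSL ℝ ν).toLinearMap (A ν) := by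
    ext1 y
    simp [hP, real_inner_comm]
  have h3 : LinearMap.trace ℝ (E n) (LinearMap.smulRight (innerSL ℝ ν).toLinearMap (A ν)) = 0 := by
    rw [LinearMap.trace_smulRight]
    simpa [real_inner_comm] using hA
  rw [h1, h2, map_sub, h3, sub_zero]

/-! ### Alternating forms -/

/-- The frame consisting of the normal and the coordinate tangent vectors. -/
def frame (L : Coord n →L[ℝ] E n) (ν : E n) : Fin (n + 1) → E n :=
  Fin.cons ν fun j => L (coordVec j)

lemma frame_expand {L : Coord n →L[ℝ] E n} {ν : E n} {P : E n →L[ℝ] Coord n}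
    (hP : ∀ y, L (P y) = y - ⟪y, ν⟫ • ν) (y : E n) :
    y = ∑ b, (Fin.cons ⟪y, ν⟫ (fun j => P y j) : Fin (n + 1) → ℝ) b • frame L ν b := by
  rw [Fin.sum_univ_succ]
  simp only [frame, Fin.cons_zero, Fin.cons_succ]
  rw [← map_eq_sum_coordVec, hP]
  abel

lemma basisFun_det_apply (m : Fin (n + 1) → E n) :
    (EuclideanSpace.basisFun (Fin (n + 1)) ℝ).toBasis.det m = (Matrix.of fun i j => m i j).det := by
  rw [Module.Basis.det_apply, ← Matrix.det_transpose]
  congr 1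

/-- The Euclidean volume form. -/
def volForm (n : ℕ) : E n [⋀^Fin (n + 1)]→L[ℝ] ℝ :=
  { (EuclideanSpace.basisFun (Fin (n + 1)) ℝ).toBasis.det with
    cont := by
      have h : Continuous fun m : Fin (n + 1) → E n => (Matrix.of fun i j => m i j).det := by
        fun_prop
      exact h.congr fun m => (basisFun_det_apply m).symm }

lemma volForm_eq_det (m : Fin (n + 1) → E n) : volForm n m = (Matrix.of fun i j => m i j).det :=
  basisFun_det_apply m

/-- det(F)² = det(F Fᵀ) is the Gram determinant of the frame, whose first row is (1, 0, …, 0). Hence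
√(det g) is the absolute value of a determinant that is smooth in the frame. -/
lemma volForm_frame_sq {L : Coord n →L[ℝ] E n} {ν : E n} (hν : ‖ν‖ = 1)
    (hLν : ∀ v, ⟪L v, ν⟫ = 0) : volForm n (frame L ν) ^ 2 = (gramMatrix L).det := by
  have h : (Matrix.of fun i j => frame L ν i j) * (Matrix.of fun i j => frame L ν i j).transpose
      = Matrix.of fun i j => ⟪frame L ν i, frame L ν j⟫ := by
    ext i j
    simp [Matrix.mul_apply, PiLp.inner_apply, mul_comm]
  have hνν : ⟪ν, ν⟫ = 1 := by rw [real_inner_self_eq_norm_sq, hν]; norm_num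
  rw [volForm_eq_det, sq]
  nth_rw 2 [← Matrix.det_transpose]
  rw [← Matrix.det_mul, h, Matrix.det_succ_row_zero, Fin.sum_univ_succ, Finset.sum_eq_zero]
  · simp only [frame, Matrix.of_apply, Fin.cons_zero, hνν]
    simp only [Fin.val_zero, pow_zero, one_mul, add_zero]
    congr 1
  · intro j _
    have : ⟪frame L ν 0, frame L ν j.succ⟫ = 0 := by
      rw [real_inner_comm]
      simp [frame, hLν]
    simp [this]

variable {ι F : Type*} [Fintype ι] [DecidableEq ι] [AddCommGroup F] [Module ℝ F]

/-- Cramer's rule: every summand other than `c = a` repeats a vector. -/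
lemma alternating_update (η : F [⋀^ι]→ₗ[ℝ] ℝ) (M : ι → F) (a : ι) (x : ι → ℝ) :
    η (Function.update M a (∑ c, x c • M c)) = x a * η M := by
  rw [η.map_update_sum, Finset.sum_eq_single a]
  · rw [η.map_update_smul, Function.update_eq_self, smul_eq_mul]
  · intro b _ hb
    rw [η.map_update_smul, η.map_update_self _ (Ne.symm hb), smul_zero]
  · simp

/-- Cramer's rule for two slots, which yields a 2×2 minor. Its antisymmetry in `a` and `b` is what
later cancels the second derivatives. -/
lemma alternating_update_update (η : F [⋀^ι]→ₗ[ℝ] ℝ) (M : ι → F) {a b : ι} (hab : a ≠ b)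
    (x y : ι → ℝ) :
    η (Function.update (Function.update M a (∑ c, x c • M c)) b (∑ c, y c • M c))
      = (x a * y b - x b * y a) * η M := by
  set X := ∑ c, x c • M c
  have hterm : ∀ c, η (Function.update (Function.update M a X) b (M c))
      = if c = b then x a * η M else if c = a then - x b * η M else 0 := by
    intro c
    split_ifs with h1 h2
    · subst h1
      have : Function.update (Function.update M a X) c (M c) = Function.update M a X := by
        conv_lhs => rw [Function.update_comm hab]
        rw [Function.update_eq_self]
      rw [this, alternating_update]
    · subst h2
      have : Function.update (Function.update M c X) b (M c)
          = (Function.update M b X) ∘ Equiv.swap c b := by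
        ext1 d
        by_cases hdc : d = c
        · subst hdc; simp [hab]
        · by_cases hdb : d = b
          · subst hdb; simp [hab]
          · simp [hdc, hdb, Equiv.swap_apply_of_ne_of_ne]
      rw [this, η.map_swap _ hab, alternating_update]
      ring
    · refine η.map_eq_zero_of_eq _ (i := b) (j := c) ?_ (Ne.symm h1)
      simp [h1, h2]
  rw [η.map_update_sum]
  simp only [η.map_update_smul, smul_eq_mul, hterm]
  have : ∀ c, y c * (if c = b then x a * η M else if c = a then - x b * η M else 0)
      = (if c = b then y c * (x a * η M) else 0) + (if c = a then y c * (- x b * η M) else 0) := by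
    intro c
    by_cases h1 : c = b
    · have : c ≠ a := fun h => hab (h ▸ h1)
      simp [h1, hab.symm]
    · simp [h1]
  simp only [this, Finset.sum_add_distrib, Finset.sum_ite_eq', Finset.mem_univ, if_true]
  ring

/-- The pointwise identity behind the divergence of the tangential part of the position field. -/
lemma sum_alternating_derivative {L : Coord n →L[ℝ] E n} {ν : E n} {P : E n →L[ℝ] Coord n}
    (hP : ∀ y, L (P y) = y - ⟪y, ν⟫ • ν) (η : E n [⋀^Fin (n + 1)]→ₗ[ℝ] ℝ) (X : E n)
    (h : Fin n → E n) (hh : ∀ i, ⟪h i, ν⟫ = 0) (Q : Fin n → Fin n → E n)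
    (hQ : ∀ i j, Q i j = Q j i) :
    ∑ i, ∑ b, η (Function.update (Function.update (frame L ν) (Fin.succ i) X) b
      ((Fin.cons (h i) (Function.update (Q i) i (L (coordVec i))) : Fin (n + 1) → E n) b))
      = (n - ⟪X, ν⟫ * ∑ i, P (h i) i) * η (frame L ν) := by
  set D := η (frame L ν)
  -- The slots contribute separately: the normal gives the curvature term, the slot holding `X`
  -- gives `D` because the derivative of the position is `L`, and each other slot gives a minor in
  -- the second derivatives `Q i j`.
  have key : ∀ i : Fin n, ∑ b, η (Function.update (Function.update (frame L ν) (Fin.succ i) X) b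
      ((Fin.cons (h i) (Function.update (Q i) i (L (coordVec i))) : Fin (n + 1) → E n) b))
      = -(⟪X, ν⟫ * P (h i) i) * D + (D + ∑ j, (P X i * P (Q i j) j - P X j * P (Q i j) i) * D) := by
    intro i
    rw [Fin.sum_univ_succ]
    congr 1
    · rw [Fin.cons_zero]
      conv_lhs => rw [frame_expand hP X, frame_expand hP (h i)]
      rw [alternating_update_update η _ (Fin.succ_ne_zero i)]
      simp [hh, D]
    · have : ∀ j : Fin n, η (Function.update (Function.update (frame L ν) (Fin.succ i) X)
          (Fin.succ j) (Function.update (Q i) i (L (coordVec i)) j))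
          = (if j = i then D else 0) + (P X i * P (Q i j) j - P X j * P (Q i j) i) * D := by
        intro j
        by_cases hj : j = i
        · subst hj
          have : L (coordVec j) = frame L ν j.succ := by simp [frame]
          simp only [Function.update_idem, Function.update_self, if_true]
          rw [this, Function.update_eq_self]
          ring
        · rw [Function.update_of_ne hj]
          conv_lhs => rw [frame_expand hP X, frame_expand hP (Q i j)]
          rw [alternating_update_update η _ (by simpa using Ne.symm hj)]
          simp [hj, D]
      simp only [Fin.cons_succ, this, Finset.sum_add_distrib]
      simp
  simp only [key, Finset.sum_add_distrib]
  -- The summand is antisymmetric in `(i, j)`, since `Q` is symmetric.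
  have anti : ∑ i, ∑ j, (P X i * P (Q i j) j - P X j * P (Q i j) i) * D = 0 := by
    have h1 : ∑ i, ∑ j, (P X i * P (Q i j) j - P X j * P (Q i j) i) * D
        = ∑ i, ∑ j, (P X j * P (Q j i) i - P X i * P (Q j i) j) * D := Finset.sum_comm
    have h2 : ∑ i, ∑ j, (P X j * P (Q j i) i - P X i * P (Q j i) j) * D
        = - ∑ i, ∑ j, (P X i * P (Q i j) j - P X j * P (Q i j) i) * D := by
      rw [← Finset.sum_neg_distrib]
      refine Finset.sum_congr rfl fun i _ => ?_
      rw [← Finset.sum_neg_distrib]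
      refine Finset.sum_congr rfl fun j _ => ?_
      rw [hQ j i]; ring
    linarith
  rw [anti, ← Finset.sum_mul, Finset.sum_neg_distrib, ← Finset.mul_sum]
  simp
  ring

end LinearAlgebra

/-! ### The divergence theorem on the half-space -/

section HalfSpace

variable {n : ℕ} [NeZero n]

lemma uniqueDiffOn_halfSpace : UniqueDiffOn ℝ (range (𝓡∂ n)) := (𝓡∂ n).uniqueDiffOn

lemma isClosed_halfSpace : IsClosed (range (𝓡∂ n)) := (𝓡∂ n).isClosed_range

lemma measurableSet_halfSpace : MeasurableSet (range (𝓡∂ n)) := isClosed_halfSpace.measurableSet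

/-- The divergence of a vector field on the half-space. -/
def coordDiv (W : Coord n → Coord n) (u : Coord n) : ℝ :=
  ∑ i, fderivWithin ℝ W (range (𝓡∂ n)) u (coordVec i) i

lemma coordDiv_continuousOn {W : Coord n → Coord n} (hW : ContDiffOn ℝ 1 W (range (𝓡∂ n))) :
    ContinuousOn (coordDiv W) (range (𝓡∂ n)) := by
  have h := hW.continuousOn_fderivWithin uniqueDiffOn_halfSpace le_rfl
  unfold coordDiv
  fun_prop

lemma coordDiv_eq_zero {W : Coord n → Coord n} {K : Set (Coord n)} (hK : IsCompact K)
    (hWK : ∀ u ∈ range (𝓡∂ n), u ∉ K → W u = 0) {u : Coord n} (hu : u ∈ range (𝓡∂ n))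
    (huK : u ∉ K) : coordDiv W u = 0 := by
  have h : W =ᶠ[nhdsWithin u (range (𝓡∂ n))] fun _ => 0 := by
    filter_upwards [self_mem_nhdsWithin,
      mem_nhdsWithin_of_mem_nhds (hK.isClosed.isOpen_compl.mem_nhds huK)] with v hv hvK
    exact hWK v hv hvK
  rw [coordDiv, h.fderivWithin_eq (hWK u hu huK)]
  simp

/-- The support is enclosed in the box [0,R] × [-R,R]ⁿ⁻¹. All its faces miss `K` except the one in
the boundary of the half-space, where the normal component vanishes by `h0`. -/
theorem integral_coordDiv_eq_zero {W : Coord n → Coord n}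
    (hW : ContDiffOn ℝ 1 W (range (𝓡∂ n))) {K : Set (Coord n)} (hK : IsCompact K)
    (hWK : ∀ u ∈ range (𝓡∂ n), u ∉ K → W u = 0) (h0 : ∀ u : Coord n, u 0 = 0 → W u 0 = 0) :
    IntegrableOn (coordDiv W) (range (𝓡∂ n)) ∧ ∫ u in range (𝓡∂ n), coordDiv W u = 0 := by
  obtain ⟨m, rfl⟩ : ∃ m, n = m + 1 := ⟨n - 1, (Nat.succ_pred_eq_of_ne_zero (NeZero.ne n)).symm⟩
  obtain ⟨R, hR0, hR⟩ : ∃ R : ℝ, 0 < R ∧ ∀ u ∈ K, ‖u‖ < R := by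
    obtain ⟨R, hR⟩ := hK.isBounded.exists_norm_le
    exact ⟨max R 0 + 1, by positivity, fun u hu =>
      lt_of_le_of_lt ((hR u hu).trans (le_max_left R 0)) (lt_add_one _)⟩
  let a : Fin (m + 1) → ℝ := Function.update (fun _ => -R) 0 0
  let b : Fin (m + 1) → ℝ := fun _ => R
  have ha0 : a 0 = 0 := by simp [a]
  have hai : ∀ i, i ≠ 0 → a i = -R := fun i hi => by simp [a, hi]
  have hle : a ≤ b := by
    intro i
    by_cases hi : i = 0
    · subst hi; rw [ha0]; exact hR0.le
    · rw [hai i hi]; simp only [b]; linarith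
  have hcoord : ∀ (u : Coord (m + 1)) i, |u i| ≤ ‖u‖ := fun u i => by
    simpa using PiLp.norm_apply_le u i
  let B : Set (Coord (m + 1)) := {u | WithLp.ofLp u ∈ Icc a b}
  have hBH : B ⊆ range (𝓡∂ (m + 1)) := by
    rw [range_modelWithCornersEuclideanHalfSpace]
    intro u hu
    have := hu.1 0
    rwa [ha0] at this
  have hKB : ∀ u ∈ range (𝓡∂ (m + 1)), u ∉ B → u ∉ K := by
    rw [range_modelWithCornersEuclideanHalfSpace]
    intro u hu huB huK
    refine huB ⟨fun i => ?_, fun i => ?_⟩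
    · by_cases hi : i = 0
      · subst hi; rw [ha0]; exact hu
      · rw [hai i hi]; exact (abs_le.1 ((hcoord u i).trans (hR u huK).le)).1
    · exact (abs_le.1 ((hcoord u i).trans (hR u huK).le)).2
  have hBmeas : IsCompact B := by
    have : B = (fun x => WithLp.toLp 2 x) '' Icc a b := by
      ext u
      constructor
      · intro hu; exact ⟨WithLp.ofLp u, hu, rfl⟩
      · rintro ⟨x, hx, rfl⟩; exact hx
    rw [this]
    exact isCompact_Icc.image (PiLp.continuous_toLp 2 _)
  have hzero : ∀ u ∈ range (𝓡∂ (m + 1)) \ B, coordDiv W u = 0 := fun u hu =>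
    coordDiv_eq_zero hK hWK hu.1 (hKB u hu.1 hu.2)
  have hcont := coordDiv_continuousOn hW
  have hintB : IntegrableOn (coordDiv W) B := (hcont.mono hBH).integrableOn_compact hBmeas
  refine ⟨hintB.of_forall_sdiff_eq_zero measurableSet_halfSpace hzero, ?_⟩
  rw [setIntegral_eq_of_subset_of_forall_sdiff_eq_zero measurableSet_halfSpace hBH hzero]
  let ofL : Coord (m + 1) ≃L[ℝ] (Fin (m + 1) → ℝ) := PiLp.continuousLinearEquiv 2 ℝ _
  have hpres := PiLp.volume_preserving_toLp (Fin (m + 1))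
  have hemb : MeasurableEmbedding (fun x : Fin (m + 1) → ℝ => (WithLp.toLp 2 x : Coord (m + 1))) :=
    (MeasurableEquiv.toLp 2 (Fin (m + 1) → ℝ)).measurableEmbedding
  rw [← hpres.setIntegral_preimage_emb hemb]
  have hpre : (fun x : Fin (m + 1) → ℝ => (WithLp.toLp 2 x : Coord (m + 1))) ⁻¹' B = Icc a b := rfl
  rw [hpre]
  let f : (Fin (m + 1) → ℝ) → (Fin (m + 1) → ℝ) := fun x => WithLp.ofLp (W (WithLp.toLp 2 x))
  let f' : (Fin (m + 1) → ℝ) → (Fin (m + 1) → ℝ) →L[ℝ] (Fin (m + 1) → ℝ) := fun x =>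
    (ofL : Coord (m + 1) →L[ℝ] _).comp
      ((fderivWithin ℝ W (range (𝓡∂ (m + 1))) (WithLp.toLp 2 x)).comp
        (ofL.symm : (Fin (m + 1) → ℝ) →L[ℝ] Coord (m + 1)))
  have hdiv : ∀ x : Fin (m + 1) → ℝ,
      coordDiv W (WithLp.toLp 2 x) = ∑ i, f' x (Pi.single i 1) i := fun x => rfl
  have hmaps : MapsTo (fun x : Fin (m + 1) → ℝ => (WithLp.toLp 2 x : Coord (m + 1))) (Icc a b) B :=
    fun x hx => hx
  have hfc : ContinuousOn f (Icc a b) :=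
    (PiLp.continuous_ofLp 2 _).comp_continuousOn
      ((hW.continuousOn.mono hBH).comp (PiLp.continuous_toLp 2 _).continuousOn hmaps)
  have hHnhds : ∀ u : Coord (m + 1), 0 < u 0 → range (𝓡∂ (m + 1)) ∈ nhds u := by
    intro u hu
    rw [← mem_interior_iff_mem_nhds, interior_range_modelWithCornersEuclideanHalfSpace]
    exact hu
  have key := integral_divergence_of_hasFDerivAt_off_countable a b hle f f' ∅ countable_empty hfc
    (by
      intro x hx
      have hx0 : 0 < (WithLp.toLp 2 x : Coord (m + 1)) 0 := by
        have := (hx.1 0 (mem_univ _)).1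
        rwa [ha0] at this
      have hd : HasFDerivAt W (fderivWithin ℝ W (range (𝓡∂ (m + 1))) (WithLp.toLp 2 x))
          (WithLp.toLp 2 x) :=
        ((hW.differentiableOn one_ne_zero _ (mem_of_mem_nhds (hHnhds _ hx0))).hasFDerivWithinAt
          ).hasFDerivAt (hHnhds _ hx0)
      exact ofL.hasFDerivAt.comp x (HasFDerivAt.comp x hd ofL.symm.hasFDerivAt))
    (by
      have : ContinuousOn (fun x => coordDiv W (WithLp.toLp 2 x)) (Icc a b) :=
        (hcont.mono hBH).comp (PiLp.continuous_toLp 2 _).continuousOn hmaps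
      exact this.integrableOn_compact isCompact_Icc)
  simp only [hdiv]
  refine key.trans (Finset.sum_eq_zero fun i _ => ?_)
  have hout : ∀ (t : ℝ) (y : Fin m → ℝ), R ≤ |t| →
      (WithLp.toLp 2 (i.insertNth t y) : Coord (m + 1)) ∉ K := by
    intro t y ht hmem
    have h1 := hcoord (WithLp.toLp 2 (i.insertNth t y)) i
    simp only [Fin.insertNth_apply_same] at h1
    exact absurd (hR _ hmem) (by linarith)
  have hinH : ∀ (t : ℝ) (y : Fin m → ℝ), y ∈ Icc (a ∘ i.succAbove) (b ∘ i.succAbove) →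
      a i ≤ t → (WithLp.toLp 2 (i.insertNth t y) : Coord (m + 1)) ∈ range (𝓡∂ (m + 1)) := by
    intro t y hy ht
    rw [range_modelWithCornersEuclideanHalfSpace]
    change 0 ≤ (i.insertNth t y : Fin (m + 1) → ℝ) 0
    rw [← ha0]
    have : ∀ j, a j ≤ (i.insertNth t y : Fin (m + 1) → ℝ) j := by
      intro j
      refine Fin.succAboveCases i ?_ (fun j => ?_) j
      · simpa using ht
      · simpa using hy.1 j
    exact this 0
  have hfront : ∀ y ∈ Icc (a ∘ i.succAbove) (b ∘ i.succAbove), f (i.insertNth (b i) y) i = 0 := by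
    intro y hy
    have := hWK _ (hinH (b i) y hy (hle i)) (hout _ y (le_abs_self _))
    simp [f, this]
  have hback : ∀ y ∈ Icc (a ∘ i.succAbove) (b ∘ i.succAbove), f (i.insertNth (a i) y) i = 0 := by
    intro y hy
    by_cases hi : i = 0
    · subst hi
      refine h0 _ ?_
      rw [ha0]
      simp
    · have := hWK _ (hinH (a i) y hy le_rfl) (hout _ y (by rw [hai i hi, abs_neg]; exact le_abs_self _))
      simp [f, this]
  rw [setIntegral_congr_fun measurableSet_Icc hfront, setIntegral_congr_fun measurableSet_Icc hback]
  simp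

end HalfSpace

/-! ### Calculus in a chart -/

section Euclidean

variable {n : ℕ}

/-- The tangential part of `X` multiplied by the volume of the frame, by Cramer's rule. -/
def cramerField (L : Coord n →L[ℝ] E n) (ν X : E n) : Coord n :=
  WithLp.toLp 2 fun i => volForm n (Function.update (frame L ν) (Fin.succ i) X)

lemma cramerField_eq {L : Coord n →L[ℝ] E n} {ν : E n} {P : E n →L[ℝ] Coord n}
    (hP : ∀ y, L (P y) = y - ⟪y, ν⟫ • ν) (X : E n) :
    cramerField L ν X = volForm n (frame L ν) • P X := by
  ext i
  have h := alternating_update (volForm n).toAlternatingMap (frame L ν) (Fin.succ i)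
    (Fin.cons ⟪X, ν⟫ (fun j => P X j) : Fin (n + 1) → ℝ)
  rw [← frame_expand hP X, Fin.cons_succ] at h
  simpa [cramerField, mul_comm] using h

/-- The unweighted identity div(√g X^T) = √g (n - ⟨X,N⟩ div N), up to the sign of the frame. It
follows from the product rule for the determinant and `sum_alternating_derivative`; `hsymm` is the
equality of mixed partials. -/
lemma exists_hasFDerivAt_cramerField {Φ ν : Coord n → E n} {L : Coord n → Coord n →L[ℝ] E n}
    {ν' : Coord n →L[ℝ] E n} {L' : Coord n →L[ℝ] Coord n →L[ℝ] E n} {u : Coord n}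
    (hΦ : HasFDerivAt Φ (L u) u) (hL : HasFDerivAt L L' u) (hν : HasFDerivAt ν ν' u)
    (hsymm : ∀ v w, L' v w = L' w v) (hνν' : ∀ v, ⟪ν' v, ν u⟫ = 0)
    {P : E n →L[ℝ] Coord n} (hP : ∀ y, L u (P y) = y - ⟪y, ν u⟫ • ν u) :
    ∃ w' : Coord n →L[ℝ] Coord n,
      HasFDerivAt (fun u => cramerField (L u) (ν u) (Φ u)) w' u ∧
      ∑ i, w' (coordVec i) i = (n - ⟪Φ u, ν u⟫ *
        LinearMap.trace ℝ (Coord n) (P.comp ν' : Coord n →L[ℝ] Coord n)) *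
        volForm n (frame (L u) (ν u)) := by
  -- Derivatives of the slots: the normal, then the coordinate tangent vectors, with the position
  -- vector in slot `i`, whose derivative is `L u`.
  let m' : Fin n → Fin (n + 1) → Coord n →L[ℝ] E n := fun i =>
    Fin.cons ν' (Function.update (fun j => L'.flip (coordVec j)) i (L u))
  have hm : ∀ (i : Fin n) (b : Fin (n + 1)),
      HasFDerivAt (fun u => Function.update (frame (L u) (ν u)) (Fin.succ i) (Φ u) b)
        (m' i b) u := by
    intro i b
    refine Fin.cases ?_ (fun j => ?_) b
    · have : (fun u => Function.update (frame (L u) (ν u)) (Fin.succ i) (Φ u) 0) = ν := by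
        ext1 v
        rw [Function.update_of_ne (Fin.succ_ne_zero i).symm]
        rfl
      rw [this]
      exact hν
    · by_cases hj : j = i
      · subst hj
        have : (fun u => Function.update (frame (L u) (ν u)) (Fin.succ j) (Φ u) (Fin.succ j)) = Φ := by
          ext1 v
          simp
        rw [this]
        simpa [m'] using hΦ
      · have h1 : (fun u => Function.update (frame (L u) (ν u)) (Fin.succ i) (Φ u) (Fin.succ j))
            = fun u => L u (coordVec j) := by
          ext1 v
          rw [Function.update_of_ne (by simpa using hj)]
          simp [frame]
        have h2 : m' i (Fin.succ j) = L'.flip (coordVec j) := by simp [m', hj]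
        rw [h1, h2]
        exact (hL.clm_apply (hasFDerivAt_const (coordVec j) u)).congr_fderiv (by ext1 v; simp)
  let w : Fin n → Coord n →L[ℝ] ℝ := fun i =>
    ∑ b, ((volForm n).toContinuousMultilinearMap.toContinuousLinearMap
      (fun c => Function.update (frame (L u) (ν u)) (Fin.succ i) (Φ u) c) b) ∘L (m' i b)
  have hw : ∀ i, HasFDerivAt
      (fun u => volForm n (Function.update (frame (L u) (ν u)) (Fin.succ i) (Φ u))) (w i) u :=
    fun i => HasFDerivAt.multilinear_comp (volForm n).toContinuousMultilinearMap (hm i)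
  let e : Coord n ≃L[ℝ] (Fin n → ℝ) := PiLp.continuousLinearEquiv 2 ℝ _
  refine ⟨(e.symm : (Fin n → ℝ) →L[ℝ] Coord n).comp (ContinuousLinearMap.pi w), ?_, ?_⟩
  · exact e.symm.hasFDerivAt.comp u (hasFDerivAt_pi.2 hw)
  · have h1 : ∀ i, ((e.symm : (Fin n → ℝ) →L[ℝ] Coord n).comp (ContinuousLinearMap.pi w))
        (coordVec i) i = w i (coordVec i) := fun i => rfl
    simp only [h1]
    have h2 := sum_alternating_derivative hP (volForm n).toAlternatingMap (Φ u)
      (fun i => ν' (coordVec i)) (fun i => hνν' _) (fun i j => L' (coordVec i) (coordVec j))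
      (fun i j => hsymm _ _)
    rw [trace_eq_sum_coordVec]
    refine Eq.trans ?_ h2
    refine Finset.sum_congr rfl fun i _ => ?_
    simp only [w, sum_apply, ContinuousLinearMap.comp_apply]
    refine Finset.sum_congr rfl fun b _ => ?_
    have h3 : m' i b (coordVec i) = (Fin.cons (ν' (coordVec i))
        (Function.update (fun j => L' (coordVec i) (coordVec j)) i (L u (coordVec i)))
          : Fin (n + 1) → E n) b := by
      refine Fin.cases ?_ (fun j => ?_) b
      · rfl
      · by_cases hj : j = i
        · subst hj; simp [m']
        · simp [m', hj]
    rw [h3]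
    rfl

end Euclidean

/-! ### Immersion, unit normal and divergence read in a chart -/

section Chart

variable {n : ℕ} [NeZero n] {S : Type*} [TopologicalSpace S]
  [ChartedSpace (EuclideanHalfSpace n) S]

/-- A map on the hypersurface read in the preferred chart at `x`. -/
def inChart {F : Type*} (V : S → F) (x : S) : Coord n → F := V ∘ (extChartAt (𝓡∂ n) x).symm

variable {F : Type*} [NormedAddCommGroup F] [NormedSpace ℝ F]

/-- The derivative of a map in the preferred chart at `x`. -/
def chartFDeriv (V : S → F) (x : S) (u : Coord n) : Coord n →L[ℝ] F :=
  fderivWithin ℝ (inChart V x) (range (𝓡∂ n)) u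

/-- The derivative of the inverse of the preferred chart at `x`. -/
def chartFrame (x : S) (u : Coord n) : Coord n →L[ℝ] Coord n :=
  mfderivWithin 𝓘(ℝ, Coord n) (𝓡∂ n) (extChartAt (𝓡∂ n) x).symm (range (𝓡∂ n)) u

/-- The derivative of a map, as a linear map on coordinate space. -/
def manifoldFDeriv (V : S → F) (p : S) : Coord n →L[ℝ] F := mfderiv (𝓡∂ n) 𝓘(ℝ, F) V p

lemma target_mem_nhdsWithin {x : S} {u : Coord n} (hu : u ∈ (extChartAt (𝓡∂ n) x).target) :
    (extChartAt (𝓡∂ n) x).target ∈ nhdsWithin u (range (𝓡∂ n)) :=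
  extChartAt_target_mem_nhdsWithin_of_mem hu

variable {φ N : S → E n}

lemma gramMatrix_det_eq (hN : IsUnitNormal φ N) {L : Coord n →L[ℝ] E n} {p : S}
    (hLν : ∀ v, ⟪L v, N p⟫ = 0) :
    Real.sqrt (gramMatrix L).det = |volForm n (frame L (N p))| := by
  rw [← volForm_frame_sq (hN.norm_eq_one p) hLν, Real.sqrt_sq_eq_abs]

lemma inner_manifoldFDeriv_normal (hN : IsUnitNormal φ N) (p : S) (v : Coord n) :
    ⟪manifoldFDeriv φ p v, N p⟫ = 0 := by
  rw [map_eq_sum_coordVec, sum_inner]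
  refine Finset.sum_eq_zero fun i _ => ?_
  rw [real_inner_smul_left]
  have : ⟪manifoldFDeriv φ p (coordVec i), N p⟫ = 0 := hN.orthogonal p i
  rw [this, mul_zero]

variable [IsManifold (𝓡∂ n) ∞ S]

lemma isManifold_one : IsManifold (𝓡∂ n) 1 S := IsManifold.of_le (n := ∞) (by simp)

lemma exists_chartFrame_eq {x : S} {u : Coord n} (hu : u ∈ (extChartAt (𝓡∂ n) x).target) :
    ∃ A : Coord n ≃L[ℝ] Coord n, (A : Coord n →L[ℝ] Coord n) = chartFrame x u := by
  have := isManifold_one (n := n) (S := S)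
  exact isInvertible_mfderivWithin_extChartAt_symm (I := 𝓡∂ n) hu

lemma chartFDeriv_eq {V : S → F} (hV : MDifferentiable (𝓡∂ n) 𝓘(ℝ, F) V) {x : S} {u : Coord n}
    (hu : u ∈ (extChartAt (𝓡∂ n) x).target) :
    chartFDeriv V x u
      = (manifoldFDeriv V ((extChartAt (𝓡∂ n) x).symm u)).comp (chartFrame x u) := by
  have := isManifold_one (n := n) (S := S)
  have huniq : UniqueMDiffWithinAt 𝓘(ℝ, Coord n) (range (𝓡∂ n)) u :=
    (uniqueDiffOn_halfSpace u (extChartAt_target_subset_range x hu)).uniqueMDiffWithinAt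
  have h := mfderiv_comp_mfderivWithin u (hV ((extChartAt (𝓡∂ n) x).symm u))
    (mdifferentiableWithinAt_extChartAt_symm (I := 𝓡∂ n) hu) huniq
  rw [mfderivWithin_eq_fderivWithin] at h
  exact h

lemma inChart_contDiffWithinAt {V : S → F} (hV : ContMDiff (𝓡∂ n) 𝓘(ℝ, F) ∞ V) {x : S}
    {u : Coord n} (hu : u ∈ (extChartAt (𝓡∂ n) x).target) :
    ContDiffWithinAt ℝ ∞ (inChart V x) (range (𝓡∂ n)) u := by
  have h := hV.contMDiffAt.comp_contMDiffWithinAt u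
    (contMDiffWithinAt_extChartAt_symm_range (I := 𝓡∂ n) (n := ∞) x hu)
  exact contMDiffWithinAt_iff_contDiffWithinAt.1 h

lemma inChart_hasFDerivWithinAt {V : S → F} (hV : ContMDiff (𝓡∂ n) 𝓘(ℝ, F) ∞ V) {x : S}
    {u : Coord n} (hu : u ∈ (extChartAt (𝓡∂ n) x).target) :
    HasFDerivWithinAt (inChart V x) (chartFDeriv V x u) (range (𝓡∂ n)) u :=
  ((inChart_contDiffWithinAt hV hu).differentiableWithinAt (by simp)).hasFDerivWithinAt

lemma chartFDeriv_contDiffWithinAt {V : S → F} (hV : ContMDiff (𝓡∂ n) 𝓘(ℝ, F) ∞ V) {x : S}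
    {u : Coord n} (hu : u ∈ (extChartAt (𝓡∂ n) x).target) :
    ContDiffWithinAt ℝ ∞ (chartFDeriv V x) (range (𝓡∂ n)) u :=
  (inChart_contDiffWithinAt hV hu).fderivWithin_right uniqueDiffOn_halfSpace
    (by simp) (extChartAt_target_subset_range x hu)

lemma chartFDeriv_injective (hφ : IsSmoothImmersion φ) {x : S} {u : Coord n}
    (hu : u ∈ (extChartAt (𝓡∂ n) x).target) : Function.Injective (chartFDeriv φ x u) := by
  obtain ⟨A, hA⟩ := exists_chartFrame_eq hu
  rw [chartFDeriv_eq (hφ.1.mdifferentiable (by simp)) hu, ← hA]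
  exact (hφ.2 _).comp A.injective

lemma inner_chartFDeriv_normal (hφ : IsSmoothImmersion φ) (hN : IsUnitNormal φ N) {x : S}
    {u : Coord n} (hu : u ∈ (extChartAt (𝓡∂ n) x).target) (v : Coord n) :
    ⟪chartFDeriv φ x u v, N ((extChartAt (𝓡∂ n) x).symm u)⟫ = 0 := by
  rw [chartFDeriv_eq (hφ.1.mdifferentiable (by simp)) hu]
  exact inner_manifoldFDeriv_normal hN _ _

/-- Differentiate ⟨N,N⟩ = 1. Unique differentiability of the half-space makes this valid at boundary
points too. -/
lemma inner_chartFDeriv_normal_self (hN : IsUnitNormal φ N) {x : S}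
    {u : Coord n} (hu : u ∈ (extChartAt (𝓡∂ n) x).target) (v : Coord n) :
    ⟪chartFDeriv N x u v, N ((extChartAt (𝓡∂ n) x).symm u)⟫ = 0 := by
  have h := inChart_hasFDerivWithinAt hN.smooth hu
  have h1 := h.inner ℝ h
  have h2 : (fun t : Coord n => ⟪inChart N x t, inChart N x t⟫) = fun _ => (1 : ℝ) := by
    ext1 t
    rw [real_inner_self_eq_norm_sq, inChart, Function.comp_apply, hN.norm_eq_one, one_pow]
  rw [h2] at h1
  have h3 := (uniqueDiffOn_halfSpace u (extChartAt_target_subset_range x hu)).eq h1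
    (hasFDerivWithinAt_const _ _ _)
  have h4 := congrArg (fun T : Coord n →L[ℝ] ℝ => T v) h3
  simp [real_inner_comm] at h4
  rw [real_inner_comm]
  exact h4

/-- `mfderiv` uses the preferred chart at the point itself, while the integration takes place in the
fixed chart at `x`. The two frames differ by the invertible `chartFrame`, which does not affect the
relative divergence. -/
lemma surfaceDiv_eq_gramDiv (hφ : IsSmoothImmersion φ) (hN : IsUnitNormal φ N) {x : S}
    {u : Coord n} (hu : u ∈ (extChartAt (𝓡∂ n) x).target) :
    surfaceDiv φ N ((extChartAt (𝓡∂ n) x).symm u)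
      = gramDiv (chartFDeriv φ x u) (chartFDeriv N x u) := by
  set p := (extChartAt (𝓡∂ n) x).symm u
  have h0 : surfaceDiv φ N p = gramDiv (manifoldFDeriv φ p) (manifoldFDeriv N p) := rfl
  obtain ⟨A, hA⟩ := exists_chartFrame_eq hu
  have hB : ∀ v : Coord n, ⟪manifoldFDeriv N p v, N p⟫ = 0 := by
    intro v
    have h := inner_chartFDeriv_normal_self hN hu (A.symm v)
    rw [chartFDeriv_eq (hN.smooth.mdifferentiable (by simp)) hu, ← hA] at h
    simpa only [ContinuousLinearMap.comp_apply, ContinuousLinearEquiv.coe_coe,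
      ContinuousLinearEquiv.apply_symm_apply] using h
  rw [h0, chartFDeriv_eq (hφ.1.mdifferentiable (by simp)) hu,
    chartFDeriv_eq (hN.smooth.mdifferentiable (by simp)) hu, ← hA]
  exact (gramDiv_comp_equiv (hφ.2 p) (hN.norm_eq_one p) (inner_manifoldFDeriv_normal hN p) hB A).symm

lemma chartAreaDensity_eq (hφ : IsSmoothImmersion φ) (hN : IsUnitNormal φ N) {x : S}
    {u : Coord n} (hu : u ∈ (extChartAt (𝓡∂ n) x).target) :
    chartAreaDensity φ x u
      = |volForm n (frame (chartFDeriv φ x u) (inChart N x u))| :=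
  gramMatrix_det_eq hN (inner_chartFDeriv_normal hφ hN hu)

end Chart

/-! ### Gluing the area measure -/

/-- Cutting the countable cover into disjoint pieces and summing gives a measure `ν` that restricts
to every `μ i`. It bounds the supremum from above, so on `U i` the supremum is squeezed between `μ
i` and `ν`. -/
lemma iSup_measure_restrict_eq {ι α : Type*} [MeasurableSpace α] (μ : ι → Measure α) (U : ι → Set α)
    (hU : ∀ i, MeasurableSet (U i)) (c : ℕ → ι) (hc : ⋃ k, U (c k) = univ)
    (hsupp : ∀ i, μ i (U i)ᶜ = 0)
    (hagree : ∀ i j B, MeasurableSet B → B ⊆ U i → B ⊆ U j → μ i B = μ j B) (i : ι) :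
    (⨆ j, μ j).restrict (U i) = μ i := by
  let A : ℕ → Set α := disjointed fun k => U (c k)
  have hAm : ∀ k, MeasurableSet (A k) := fun k => MeasurableSet.disjointed (fun k => hU (c k)) k
  have hAd : Pairwise (Function.onFun Disjoint A) := disjoint_disjointed _
  have hAU : ⋃ k, A k = univ := by rw [← hc]; exact iUnion_disjointed
  have hAs : ∀ k, A k ⊆ U (c k) := fun k => disjointed_subset _ k
  let ν : Measure α := Measure.sum fun k => (μ (c k)).restrict (A k)
  have hself : ∀ i, (μ i).restrict (U i) = μ i := fun i =>
    Measure.restrict_eq_self_of_ae_mem (measure_eq_zero_iff_ae_notMem.1 (hsupp i) |>.mono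
      fun x hx => not_not.1 hx)
  have hν : ∀ i, ν.restrict (U i) = μ i := by
    intro i
    ext B hB
    rw [Measure.restrict_apply hB, Measure.sum_apply _ (hB.inter (hU i))]
    have h1 : ∀ k, (μ (c k)).restrict (A k) (B ∩ U i) = μ i (B ∩ U i ∩ A k) := by
      intro k
      rw [Measure.restrict_apply (hB.inter (hU i))]
      exact hagree _ _ _ ((hB.inter (hU i)).inter (hAm k)) (inter_subset_right.trans (hAs k))
        (inter_subset_left.trans inter_subset_right)
    simp only [h1]
    rw [← measure_iUnion (fun j k hjk => (hAd hjk).mono inter_subset_right inter_subset_right)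
      (fun k => (hB.inter (hU i)).inter (hAm k)), ← inter_iUnion, hAU, inter_univ,
      ← Measure.restrict_apply hB, hself]
  have hle : ⨆ j, μ j ≤ ν := iSup_le fun j => by
    rw [← hν j]; exact Measure.restrict_le_self
  refine le_antisymm ((Measure.restrict_mono_measure hle _).trans_eq (hν i)) ?_
  conv_lhs => rw [← hself i]
  exact Measure.restrict_mono_measure (le_iSup μ i) _

/-! ### Change of charts, finiteness of the area, integration in a chart -/

section Area

variable {n : ℕ} [NeZero n] {S : Type*} [TopologicalSpace S]
  [ChartedSpace (EuclideanHalfSpace n) S] {φ N : S → E n}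

omit [NeZero n] in
lemma gramMatrix_comp (L : Coord n →L[ℝ] E n) (A : Coord n →L[ℝ] Coord n) :
    (gramMatrix (L.comp A)).det = A.det ^ 2 * (gramMatrix L).det := by
  let a : Matrix (Fin n) (Fin n) ℝ := Matrix.of fun i k => A (coordVec i) k
  have h1 : gramMatrix (L.comp A) = a * gramMatrix L * a.transpose := by
    ext i j
    simp only [gramMatrix, Matrix.of_apply, Matrix.mul_apply, ContinuousLinearMap.comp_apply,
      Matrix.transpose_apply, a]
    rw [map_eq_sum_coordVec L (A (coordVec i)), map_eq_sum_coordVec L (A (coordVec j)), inner_sum]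
    refine Finset.sum_congr rfl fun k _ => ?_
    rw [real_inner_smul_right, sum_inner, mul_comm]
    congr 1
    exact Finset.sum_congr rfl fun l _ => real_inner_smul_left _ _ _
  have h2 : a.det = A.det := by
    change _ = LinearMap.det (A : Coord n →ₗ[ℝ] Coord n)
    rw [← LinearMap.det_toMatrix (EuclideanSpace.basisFun (Fin n) ℝ).toBasis, ← Matrix.det_transpose]
    congr 1
  rw [h1, Matrix.det_mul, Matrix.det_mul, Matrix.det_transpose, h2]
  ring

lemma chartAreaDensity_eq_sqrt (x : S) (u : Coord n) :
    chartAreaDensity φ x u = Real.sqrt (gramMatrix (chartFDeriv φ x u)).det := rfl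

lemma measurableSet_target (x : S) : MeasurableSet (extChartAt (𝓡∂ n) x).target := by
  rw [extChartAt_target]
  exact (((chartAt (EuclideanHalfSpace n) x).open_target.preimage
    (𝓡∂ n).continuous_symm).measurableSet).inter measurableSet_halfSpace

variable [MeasurableSpace S] [BorelSpace S]

/-- The coordinates of the points of `B` in the preferred chart at `x`. -/
def chartPreimage (x : S) (B : Set S) : Set (Coord n) :=
  (extChartAt (𝓡∂ n) x).symm ⁻¹' B ∩ (extChartAt (𝓡∂ n) x).target

lemma measurable_target_restrict (x : S) :
    Measurable ((extChartAt (𝓡∂ n) x).target.domRestrict (extChartAt (𝓡∂ n) x).symm) :=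
  (continuousOn_iff_continuous_domRestrict.1 (continuousOn_extChartAt_symm x)).measurable

lemma measurableSet_chartPreimage (x : S) {B : Set S} (hB : MeasurableSet B) :
    MeasurableSet (chartPreimage (n := n) x B) := by
  have h := (measurableSet_target (n := n) x).subtype_image (measurable_target_restrict x hB)
  convert h using 1
  ext u
  simp only [chartPreimage, mem_inter_iff, mem_preimage, mem_image, Subtype.exists,
    exists_and_right, exists_eq_right]
  tauto

lemma aemeasurable_chart_symm (x : S) :
    AEMeasurable (extChartAt (𝓡∂ n) x).symm
      ((volume : Measure (Coord n)).restrict (extChartAt (𝓡∂ n) x).target) :=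
  (continuousOn_extChartAt_symm x).aemeasurable (measurableSet_target x)

/-- The area measure in coordinates. -/
def coordArea (φ : S → E n) (x : S) : Measure (Coord n) :=
  (volume.restrict (extChartAt (𝓡∂ n) x).target).withDensity
    fun u => ENNReal.ofReal (chartAreaDensity φ x u)

omit [MeasurableSpace S] [BorelSpace S] in
lemma coordArea_ac (x : S) :
    coordArea φ x ≪ (volume : Measure (Coord n)).restrict (extChartAt (𝓡∂ n) x).target :=
  withDensity_absolutelyContinuous _ _

lemma chartArea_apply (x : S) {B : Set S} (hB : MeasurableSet B) :
    chartArea φ x B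
      = ∫⁻ u in chartPreimage x B, ENNReal.ofReal (chartAreaDensity φ x u) := by
  rw [chartArea, ← coordArea, Measure.map_apply_of_aemeasurable
    ((aemeasurable_chart_symm x).mono_ac (coordArea_ac x)) hB, coordArea, withDensity_apply',
    Measure.restrict_restrict' (measurableSet_target x)]
  rfl

omit [BorelSpace S] [MeasurableSpace S] in
lemma chartPreimage_source_compl (x : S) :
    chartPreimage (n := n) x (extChartAt (𝓡∂ n) x).sourceᶜ = ∅ := by
  ext u
  simp only [chartPreimage, mem_inter_iff, mem_preimage, mem_compl_iff, mem_empty_iff_false,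
    iff_false, not_and]
  exact fun h hu => h ((extChartAt (𝓡∂ n) x).map_target hu)

variable [IsManifold (𝓡∂ n) ∞ S]

/-- Change of variables for the transition map `τ`: by `gramMatrix_comp` the density √(det g) picks
up exactly |det τ'|. Derivatives are taken within the half-space so that boundary points are
included. -/
lemma chartArea_agree (hφ : ContMDiff (𝓡∂ n) 𝓘(ℝ, E n) ∞ φ) (x y : S) {B : Set S}
    (hB : MeasurableSet B)
    (hx : B ⊆ (extChartAt (𝓡∂ n) x).source) (hy : B ⊆ (extChartAt (𝓡∂ n) y).source) :
    chartArea φ x B = chartArea φ y B := by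
  rw [chartArea_apply x hB, chartArea_apply y hB]
  set ex := extChartAt (𝓡∂ n) x
  set ey := extChartAt (𝓡∂ n) y
  let τ : Coord n → Coord n := ey ∘ ex.symm
  let τ' : Coord n → Coord n →L[ℝ] Coord n := fderivWithin ℝ τ (range (𝓡∂ n))
  have himg : τ '' chartPreimage x B = chartPreimage y B := by
    ext v
    constructor
    · rintro ⟨u, ⟨hu, hut⟩, rfl⟩
      have := hy hu
      refine ⟨?_, ey.map_source this⟩
      change ey.symm (ey (ex.symm u)) ∈ B
      rw [ey.left_inv this]
      exact hu
    · rintro ⟨hv, hvt⟩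
      have := hx hv
      refine ⟨ex (ey.symm v), ⟨?_, ex.map_source this⟩, ?_⟩
      · change ex.symm (ex (ey.symm v)) ∈ B
        rw [ex.left_inv this]; exact hv
      · change ey (ex.symm (ex (ey.symm v))) = v
        rw [ex.left_inv this, ey.right_inv hvt]
  have hinj : InjOn τ (chartPreimage x B) := by
    rintro u ⟨hu, hut⟩ v ⟨hv, hvt⟩ huv
    have h1 := ey.injOn (hy hu) (hy hv) huv
    exact ex.symm.injOn hut hvt h1
  have hsub : chartPreimage (n := n) x B ⊆ range (𝓡∂ n) := fun u hu =>
    extChartAt_target_subset_range x hu.2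
  have hd : ∀ u ∈ chartPreimage (n := n) x B, HasFDerivWithinAt τ (τ' u) (range (𝓡∂ n)) u := by
    intro u hu
    have h := contDiffWithinAt_ext_coord_change (I := 𝓡∂ n) (n := ∞) y x (y := u)
      ⟨hu.2, hy hu.1⟩
    exact (h.differentiableWithinAt (by simp)).hasFDerivWithinAt
  rw [← himg, lintegral_image_eq_lintegral_abs_det_fderiv_mul _
    (measurableSet_chartPreimage x hB) (fun u hu => (hd u hu).mono hsub) hinj]
  refine setLIntegral_congr_fun (measurableSet_chartPreimage x hB) fun u hu => ?_
  have hτu : τ u ∈ ey.target := ey.map_source (hy hu.1)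
  have hcomp : chartFDeriv φ x u = (chartFDeriv φ y (τ u)).comp (τ' u) := by
    have hmaps : ∀ᶠ v in nhdsWithin u (range (𝓡∂ n)), v ∈ ex.target ∧ ex.symm v ∈ ey.source := by
      filter_upwards [target_mem_nhdsWithin hu.2,
        (continuousOn_extChartAt_symm x u hu.2).mono_of_mem_nhdsWithin
          (target_mem_nhdsWithin hu.2) |>.preimage_mem_nhdsWithin
          ((isOpen_extChartAt_source y).mem_nhds (hy hu.1))] with v h1 h2
      exact ⟨h1, h2⟩
    have heq : inChart φ x =ᶠ[nhdsWithin u (range (𝓡∂ n))] inChart φ y ∘ τ := by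
      filter_upwards [hmaps] with v hv
      change φ (ex.symm v) = φ (ey.symm (ey (ex.symm v)))
      rw [ey.left_inv hv.2]
    have hu' : u ∈ range (𝓡∂ n) := hsub hu
    have hst : ∀ᶠ v in nhdsWithin u (range (𝓡∂ n)), τ v ∈ range (𝓡∂ n) := by
      filter_upwards [hmaps] with v hv
      exact extChartAt_target_subset_range y (ey.map_source hv.2)
    -- `τ` need not map the whole half-space to itself, only a relative neighbourhood of `u`, which
    -- suffices for the chain rule.
    have hset : τ ⁻¹' range (𝓡∂ n) ∈ nhdsWithin u (range (𝓡∂ n)) := hst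
    have hτw : HasFDerivWithinAt τ (τ' u) (range (𝓡∂ n) ∩ τ ⁻¹' range (𝓡∂ n)) u :=
      (hd u hu).mono inter_subset_left
    have h3 := (inChart_hasFDerivWithinAt hφ hτu).comp u hτw (fun v hv => hv.2)
    have h4 : HasFDerivWithinAt (inChart φ y ∘ τ) ((chartFDeriv φ y (τ u)).comp (τ' u))
        (range (𝓡∂ n)) u :=
      h3.mono_of_mem_nhdsWithin (Filter.inter_mem self_mem_nhdsWithin hset)
    have h5 := h4.congr_of_eventuallyEq heq (heq.self_of_nhdsWithin hu')
    exact h5.fderivWithin (uniqueDiffOn_halfSpace u hu')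
  rw [chartAreaDensity_eq_sqrt, chartAreaDensity_eq_sqrt, hcomp, gramMatrix_comp,
    Real.sqrt_mul (sq_nonneg _), Real.sqrt_sq_eq_abs, ENNReal.ofReal_mul (abs_nonneg _)]

variable [CompactSpace S]

lemma area_restrict_source (hφ : ContMDiff (𝓡∂ n) 𝓘(ℝ, E n) ∞ φ) (x : S) :
    (area φ).restrict (extChartAt (𝓡∂ n) x).source = chartArea φ x := by
  obtain ⟨s, hs, hsU⟩ := countable_cover_nhds
    (fun y : S => extChartAt_source_mem_nhds (I := 𝓡∂ n) y)
  have hne : s.Nonempty := by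
    by_contra h
    rw [not_nonempty_iff_eq_empty] at h
    subst h
    simp only [mem_empty_iff_false, iUnion_of_empty, iUnion_empty] at hsU
    exact (hsU ▸ mem_univ x : x ∈ (∅ : Set S))
  obtain ⟨c, hc⟩ := hs.exists_eq_range hne
  refine iSup_measure_restrict_eq (chartArea φ) (fun y => (extChartAt (𝓡∂ n) y).source)
    (fun y => (isOpen_extChartAt_source y).measurableSet) c ?_ (fun y => ?_)
    (fun y z B hB hy hz => chartArea_agree hφ y z hB hy hz) x
  · rw [← hsU, hc, biUnion_range]
  · rw [chartArea_apply y (isOpen_extChartAt_source y).measurableSet.compl,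
      chartPreimage_source_compl]
    simp

omit [MeasurableSpace S] [BorelSpace S] [CompactSpace S] in
lemma chartAreaDensity_continuousOn (hφ : ContMDiff (𝓡∂ n) 𝓘(ℝ, E n) ∞ φ) (x : S) :
    ContinuousOn (chartAreaDensity φ x) (extChartAt (𝓡∂ n) x).target := by
  have h : ContinuousOn (chartFDeriv φ x) (extChartAt (𝓡∂ n) x).target := fun u hu =>
    (chartFDeriv_contDiffWithinAt hφ hu).continuousWithinAt.mono (extChartAt_target_subset_range x)
  have h2 : ContinuousOn (fun u => gramMatrix (chartFDeriv φ x u))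
      (extChartAt (𝓡∂ n) x).target := by
    refine continuousOn_pi.2 fun i => continuousOn_pi.2 fun j => ?_
    exact (h.clm_apply continuousOn_const).inner (𝕜 := ℝ) (h.clm_apply continuousOn_const)
  have h3 : Continuous fun A : Matrix (Fin n) (Fin n) ℝ => Real.sqrt A.det := by fun_prop
  exact h3.comp_continuousOn h2

omit [MeasurableSpace S] [BorelSpace S] [CompactSpace S] in
lemma aemeasurable_chartAreaDensity (hφ : ContMDiff (𝓡∂ n) 𝓘(ℝ, E n) ∞ φ) (x : S) :
    AEMeasurable (chartAreaDensity φ x) (volume.restrict (extChartAt (𝓡∂ n) x).target) :=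
  (chartAreaDensity_continuousOn hφ x).aemeasurable (measurableSet_target x)

/-- Each point has a compact neighbourhood inside a chart domain, where the continuous density is
integrable; compactness of `S` does the rest. -/
lemma isFiniteMeasure_area [T2Space S] (hφ : ContMDiff (𝓡∂ n) 𝓘(ℝ, E n) ∞ φ) :
    IsFiniteMeasure (area φ) := by
  refine ⟨isCompact_univ.measure_lt_top_of_nhdsWithin fun x _ => ?_⟩
  rw [nhdsWithin_univ]
  obtain ⟨K, hK, hKs, hKc⟩ := local_compact_nhds (extChartAt_source_mem_nhds (I := 𝓡∂ n) x)
  refine ⟨K, hK, ?_⟩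
  have hKm : MeasurableSet K := hKc.isClosed.measurableSet
  have h1 : area φ K = chartArea φ x K := by
    rw [← area_restrict_source hφ x, Measure.restrict_apply hKm, inter_eq_left.2 hKs]
  have h2 : chartPreimage x K = extChartAt (𝓡∂ n) x '' K := by
    rw [(extChartAt (𝓡∂ n) x).image_eq_target_inter_inv_preimage hKs, inter_comm]; rfl
  have h3 : IsCompact (chartPreimage (n := n) x K) := by
    rw [h2]; exact hKc.image_of_continuousOn ((continuousOn_extChartAt x).mono hKs)
  rw [h1, chartArea_apply x hKm]
  have hint : IntegrableOn (chartAreaDensity φ x) (chartPreimage x K) :=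
    ((chartAreaDensity_continuousOn hφ x).mono inter_subset_right).integrableOn_compact h3
  exact hint.lintegral_lt_top

lemma isFiniteMeasure_weightedAreaMeasure [T2Space S] {f : E n → ℝ}
    (hφ : ContMDiff (𝓡∂ n) 𝓘(ℝ, E n) ∞ φ) (hf : Continuous fun p => f (φ p)) :
    IsFiniteMeasure (weightedAreaMeasure f φ) := by
  have := isFiniteMeasure_area hφ
  obtain ⟨C, hC⟩ := (isCompact_range hf).bddAbove
  refine isFiniteMeasure_withDensity (ne_of_lt ?_)
  calc ∫⁻ p, ENNReal.ofReal (f (φ p)) ∂area φ ≤ ∫⁻ _, ENNReal.ofReal C ∂area φ :=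
        lintegral_mono fun p => ENNReal.ofReal_le_ofReal (hC (mem_range_self p))
    _ < ⊤ := by
        rw [lintegral_const]
        exact ENNReal.mul_lt_top ENNReal.ofReal_lt_top (measure_lt_top _ _)

/-- Integration of a function supported in the domain of a chart. -/
lemma integral_weightedAreaMeasure_of_chart {f : E n → ℝ}
    (hφ : ContMDiff (𝓡∂ n) 𝓘(ℝ, E n) ∞ φ) (hf : Continuous fun p => f (φ p))
    (hpos : ∀ p, 0 < f (φ p)) (x : S) {F : S → ℝ}
    (hF : ∀ p ∉ (extChartAt (𝓡∂ n) x).source, F p = 0)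
    (hint : IntegrableOn (fun u => chartAreaDensity φ x u *
      (f (inChart φ x u) * inChart F x u)) (extChartAt (𝓡∂ n) x).target) :
    Integrable F (weightedAreaMeasure f φ) ∧
      ∫ p, F p ∂(weightedAreaMeasure f φ) = ∫ u in (extChartAt (𝓡∂ n) x).target,
        chartAreaDensity φ x u * (f (inChart φ x u) * inChart F x u) := by
  set e := extChartAt (𝓡∂ n) x
  let G : S → ℝ := fun p => f (φ p) * F p
  have hmeas : Measurable fun p => ENNReal.ofReal (f (φ p)) := hf.measurable.ennreal_ofReal
  have hlt : ∀ᵐ p ∂area φ, ENNReal.ofReal (f (φ p)) < ⊤ :=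
    Filter.Eventually.of_forall fun p => ENNReal.ofReal_lt_top
  have hG : ∀ p, (ENNReal.ofReal (f (φ p))).toReal • F p = G p := fun p => by
    rw [ENNReal.toReal_ofReal (hpos p).le, smul_eq_mul]
  have hGsupp : Function.support G ⊆ e.source := by
    intro p hp
    by_contra h
    exact hp (by simp [G, hF p h])
  have hdens : AEMeasurable (fun u => ENNReal.ofReal (chartAreaDensity φ x u))
      (volume.restrict e.target) := (aemeasurable_chartAreaDensity hφ x).ennreal_ofReal
  have hlt2 : ∀ᵐ u ∂(volume : Measure (Coord n)).restrict e.target,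
      ENNReal.ofReal (chartAreaDensity φ x u) < ⊤ :=
    Filter.Eventually.of_forall fun p => ENNReal.ofReal_lt_top
  have hG2 : ∀ u, (ENNReal.ofReal (chartAreaDensity φ x u)).toReal • (G ∘ e.symm) u
      = chartAreaDensity φ x u * (f (inChart φ x u) * inChart F x u) := fun u => by
    have h0 : 0 ≤ chartAreaDensity φ x u := Real.sqrt_nonneg _
    rw [ENNReal.toReal_ofReal h0, smul_eq_mul]; rfl
  have hint2 : Integrable (G ∘ e.symm) (coordArea φ x) := by
    rw [coordArea, integrable_withDensity_iff_integrable_smul₀' hdens hlt2]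
    simp only [hG2]
    exact hint
  have hsymm : AEMeasurable e.symm (coordArea φ x) :=
    (aemeasurable_chart_symm x).mono_ac (coordArea_ac x)
  have hchart : chartArea φ x = Measure.map e.symm (coordArea φ x) := rfl
  have htar : ∀ᵐ u ∂(coordArea φ x), u ∈ e.target :=
    (coordArea_ac x).ae_le (ae_restrict_mem (measurableSet_target x))
  have hsrc : ∀ᵐ p ∂(chartArea φ x), p ∈ e.source := by
    rw [← area_restrict_source hφ x]
    exact ae_restrict_mem (isOpen_extChartAt_source x).measurableSet
  have hem : AEMeasurable e (chartArea φ x) := by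
    rw [← area_restrict_source hφ x]
    exact (continuousOn_extChartAt x).aemeasurable (isOpen_extChartAt_source x).measurableSet
  have hmap : Measure.map e (chartArea φ x) = coordArea φ x := by
    rw [hchart, AEMeasurable.map_map_of_aemeasurable (hchart ▸ hem) hsymm]
    conv_rhs => rw [← Measure.map_id (μ := coordArea φ x)]
    refine Measure.map_congr ?_
    filter_upwards [htar] with u hu
    exact e.right_inv hu
  -- `F` is not assumed measurable: measurability is recovered from the coordinate expression,
  -- because the chart pushes `chartArea` back to `coordArea`.
  have hGm : AEStronglyMeasurable G (chartArea φ x) := by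
    have h1 : AEStronglyMeasurable (G ∘ e.symm) (Measure.map e (chartArea φ x)) := by
      rw [hmap]; exact hint2.aestronglyMeasurable
    refine (h1.comp_aemeasurable hem).congr ?_
    filter_upwards [hsrc] with p hp
    simp only [Function.comp_apply]
    rw [e.left_inv hp]
  constructor
  · rw [weightedAreaMeasure, integrable_withDensity_iff_integrable_smul' hmeas hlt]
    simp only [hG]
    rw [← integrableOn_iff_integrable_of_support_subset hGsupp, IntegrableOn,
      area_restrict_source hφ x, hchart, integrable_map_measure (hchart ▸ hGm) hsymm]
    exact hint2
  · rw [weightedAreaMeasure, integral_withDensity_eq_integral_toReal_smul hmeas hlt]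
    simp only [hG]
    rw [← setIntegral_eq_integral_of_forall_compl_eq_zero
      (s := e.source) (fun p hp => by simp [G, hF p hp]),
      area_restrict_source hφ x, hchart, integral_map hsymm (hchart ▸ hGm), coordArea,
      integral_withDensity_eq_integral_toReal_smul₀ hdens hlt2]
    refine integral_congr_ae (Filter.Eventually.of_forall fun u => ?_)
    exact hG2 u

/-- A set is null for the area if it is null in every chart. -/
lemma area_eq_zero_of_chart (hφ : ContMDiff (𝓡∂ n) 𝓘(ℝ, E n) ∞ φ) {B : Set S}
    (hB : MeasurableSet B) (h : ∀ x, (volume : Measure (Coord n)) (chartPreimage x B) = 0) :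
    area φ B = 0 := by
  obtain ⟨s, hs, hsU⟩ := countable_cover_nhds
    (fun y : S => extChartAt_source_mem_nhds (I := 𝓡∂ n) y)
  have hcov : B = ⋃ y ∈ s, B ∩ (extChartAt (𝓡∂ n) y).source := by
    rw [← inter_iUnion₂, hsU, inter_univ]
  rw [hcov, measure_biUnion_null_iff hs]
  intro x _
  rw [← Measure.restrict_apply hB, area_restrict_source hφ x, chartArea_apply x hB]
  exact setLIntegral_measure_zero _ _ (h x)

end Area

/-! ### Geometry of solid cones -/

section Cone

variable {n : ℕ} {M : Set (E n)}

/-- The radial projection onto the unit sphere. -/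
def radial (y : E n) : E n := ‖y‖⁻¹ • y

lemma radial_smul {t : ℝ} (ht : 0 < t) (y : E n) : radial (t • y) = radial y := by
  rw [radial, radial, norm_smul, Real.norm_of_nonneg ht.le, smul_smul]
  congr 1
  field_simp

lemma norm_radial {y : E n} (hy : y ≠ 0) : ‖radial y‖ = 1 := by
  rw [radial, norm_smul, norm_inv, norm_norm, inv_mul_cancel₀ (norm_ne_zero_iff.2 hy)]

lemma norm_smul_radial {y : E n} (hy : y ≠ 0) : ‖y‖ • radial y = y := by
  rw [radial, smul_smul, mul_inv_cancel₀ (norm_ne_zero_iff.2 hy), one_smul]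

lemma radial_contDiffAt {y : E n} (hy : y ≠ 0) : ContDiffAt ℝ ∞ radial y :=
  ((contDiffAt_norm ℝ hy).inv (norm_ne_zero_iff.2 hy)).smul contDiffAt_id

/-- Since `v` is orthogonal to `q`, the norm is stationary along the line and only the scaling
factor remains. -/
lemma hasDerivAt_radial_line {q v : E n} (hq : q ≠ 0) (hv : ⟪q, v⟫ = 0) :
    HasDerivAt (fun s : ℝ => radial (q + s • v)) (‖q‖⁻¹ • v) 0 := by
  have hline : HasDerivAt (fun s : ℝ => q + s • v) v 0 := by
    simpa using ((hasDerivAt_id (0 : ℝ)).smul_const v).const_add q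
  have h0 : q + (0 : ℝ) • v = q := by simp
  have hnorm : HasDerivAt (fun s : ℝ => ‖q + s • v‖⁻¹) 0 0 := by
    have h1 : HasDerivAt (fun s : ℝ => ‖q + s • v‖ ^ 2) 0 0 := by
      have := hline.norm_sq
      simpa [hv] using this
    have h2 : HasDerivAt (fun s : ℝ => Real.sqrt (‖q + s • v‖ ^ 2)) 0 0 := by
      have := h1.sqrt (by simpa using hq)
      simpa using this
    have h3 : (fun s : ℝ => Real.sqrt (‖q + s • v‖ ^ 2)) = fun s : ℝ => ‖q + s • v‖ := by
      ext1 s; exact Real.sqrt_sq (norm_nonneg _)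
    rw [h3] at h2
    simpa using h2.fun_inv (by simpa using hq)
  have := hnorm.fun_smul hline
  simpa [radial] using this

lemma coneOver_radial {D : Set (E n)} {y : E n} (hy : y ≠ 0) (h : radial y ∈ D) :
    y ∈ coneOver D := ⟨‖y‖, norm_nonneg y, radial y, h, (norm_smul_radial hy).symm⟩

lemma radial_mem {D : Set (E n)} (hD : D ⊆ Metric.sphere 0 1) {y : E n} (hy : y ≠ 0)
    (h : y ∈ coneOver D) : radial y ∈ D := by
  obtain ⟨t, ht, p, hp, rfl⟩ := h
  have htp : 0 < t := lt_of_le_of_ne ht fun h => hy (by rw [← h, zero_smul])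
  rw [radial_smul htp, radial, mem_sphere_zero_iff_norm.1 (hD hp), inv_one, one_smul]
  exact hp

lemma smul_mem_punctured (hM : IsSolidCone M) {t : ℝ} (ht : 0 < t) {y : E n}
    (hy : y ∈ punctured M) : t • y ∈ punctured M := by
  obtain ⟨D, -, rfl⟩ := hM
  obtain ⟨⟨s, hs, p, hp, rfl⟩, hy0⟩ := hy
  exact ⟨⟨t * s, by positivity, p, hp, by rw [smul_smul]⟩, smul_ne_zero ht.ne' hy0⟩

/-- Homogeneous local defining function of the boundary of a solid cone. -/
structure IsDefiningFunction (M W : Set (E n)) (G : E n → ℝ) : Prop where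
  isOpen : IsOpen W
  smul_mem : ∀ y ∈ W, ∀ t : ℝ, 0 < t → t • y ∈ W
  smooth : ContDiffOn ℝ ∞ G W
  homogeneous : ∀ y ∈ W, ∀ t : ℝ, 0 < t → G (t • y) = G y
  fderiv_ne : ∀ y ∈ W, fderiv ℝ G y ≠ 0
  frontier : ∀ y ∈ W, y ∈ _root_.frontier M → G y = 0
  neg : ∀ y ∈ W, G y < 0 → y ∈ punctured M

lemma fderiv_smul_of_homogeneous {F : Type*} [NormedAddCommGroup F] [NormedSpace ℝ F]
    {W : Set (E n)} {G : E n → F} (hW : IsOpen W)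
    (hWs : ∀ y ∈ W, ∀ t : ℝ, 0 < t → t • y ∈ W) (hG : DifferentiableOn ℝ G W)
    (hh : ∀ y ∈ W, ∀ t : ℝ, 0 < t → G (t • y) = G y) {y : E n} (hy : y ∈ W) {t : ℝ} (ht : 0 < t) :
    fderiv ℝ G (t • y) = t⁻¹ • fderiv ℝ G y := by
  have h1 : HasFDerivAt G (fderiv ℝ G (t • y)) (t • y) :=
    (hG.differentiableAt (hW.mem_nhds (hWs y hy t ht))).hasFDerivAt
  have h2 : HasFDerivAt (fun z : E n => t • z) (t • ContinuousLinearMap.id ℝ (E n)) y :=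
    (hasFDerivAt_id y).const_smul t
  have h3 := HasFDerivAt.comp y h1 h2
  have h4 : (G ∘ fun z : E n => t • z) =ᶠ[nhds y] G := by
    filter_upwards [hW.mem_nhds hy] with z hz
    exact hh z hz t ht
  have h5 := (h3.congr_of_eventuallyEq h4.symm).fderiv
  rw [h5]
  ext v
  simp [ht.ne']

/-- Compose the spherical defining function `g` with the radial projection. The domain is the open,
scaling-invariant set where the projection lies in the domain of `g` and the differential of the
composite does not vanish. -/
lemma exists_definingFunction (hM : IsSolidCone M) {q : E n} (hq : q ∈ punctured M)
    (hqf : q ∈ frontier M) : ∃ W G, IsDefiningFunction M W G ∧ q ∈ W := by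
  obtain ⟨D, ⟨U, ⟨O, hO, hUO⟩, -, rfl, hloc⟩, rfl⟩ := hM
  have hUs : U ⊆ Metric.sphere 0 1 := by rw [hUO]; exact inter_subset_left
  have hDs : closure U ⊆ Metric.sphere 0 1 := closure_minimal hUs Metric.isClosed_sphere
  have hrc : ∀ {y : E n}, y ≠ 0 → ContinuousAt radial y := fun hy => (radial_contDiffAt hy).continuousAt
  have hopen : ∀ V : Set (E n), IsOpen V → IsOpen {y : E n | y ≠ 0 ∧ radial y ∈ V} := by
    intro V hV
    rw [isOpen_iff_mem_nhds]
    rintro y ⟨hy, hyV⟩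
    exact Filter.inter_mem (isOpen_ne.mem_nhds hy) ((hrc hy).preimage_mem_nhds (hV.mem_nhds hyV))
  -- Off the vertex the cone over the relatively open `U` is open, so frontier points project to
  -- `closure U \ U`.
  have hint : ∀ y : E n, y ≠ 0 → radial y ∈ U → y ∈ interior (coneOver (closure U)) := by
    intro y hy hyU
    rw [hUO] at hyU
    refine mem_interior.2 ⟨_, ?_, hopen O hO, hy, hyU.2⟩
    rintro z ⟨hz, hzO⟩
    refine coneOver_radial hz (subset_closure ?_)
    rw [hUO]
    exact ⟨mem_sphere_zero_iff_norm.2 (norm_radial hz), hzO⟩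
  have hfront : ∀ y : E n, y ≠ 0 → y ∈ frontier (coneOver (closure U)) →
      radial y ∈ closure U \ U := by
    intro y hy hyf
    refine ⟨?_, fun h => hyf.2 (hint y hy h)⟩
    have h1 : y ∈ closure (coneOver (closure U) ∩ {0}ᶜ) :=
      mem_closure_iff_nhds.2 fun t ht => by
        obtain ⟨z, hz, hz'⟩ := mem_closure_iff_nhds.1 hyf.1 (t ∩ {0}ᶜ)
          (Filter.inter_mem ht (isOpen_compl_singleton.mem_nhds hy))
        exact ⟨z, hz.1, hz', hz.2⟩
    have h2 := (hrc hy).continuousWithinAt.mem_closure_image h1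
    rw [← closure_closure (s := U)]
    refine closure_mono ?_ h2
    rintro _ ⟨z, ⟨hz, hz0⟩, rfl⟩
    exact radial_mem hDs hz0 hz
  have hq0 : q ≠ 0 := hq.2
  obtain ⟨W, g, hW, hpW, hg, ⟨v, hv, hgv⟩, hUW⟩ := hloc (radial q) (hfront q hq0 hqf)
  let W₁ : Set (E n) := {y | y ≠ 0 ∧ radial y ∈ W}
  let G : E n → ℝ := fun y => g (radial y)
  have hW₁ : IsOpen W₁ := hopen W hW
  have hW₁s : ∀ y ∈ W₁, ∀ t : ℝ, 0 < t → t • y ∈ W₁ := fun y hy t ht =>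
    ⟨smul_ne_zero ht.ne' hy.1, by rw [radial_smul ht]; exact hy.2⟩
  have hGs : ContDiffOn ℝ ∞ G W₁ := fun y hy =>
    (hg.contDiffAt.comp y (radial_contDiffAt hy.1)).contDiffWithinAt
  have hGh : ∀ y ∈ W₁, ∀ t : ℝ, 0 < t → G (t • y) = G y := fun y _ t ht => by
    simp only [G, radial_smul ht]
  have hdc : ContinuousOn (fderiv ℝ G) W₁ := hGs.continuousOn_fderiv_of_isOpen hW₁ (by simp)
  refine ⟨W₁ ∩ {y | fderiv ℝ G y ≠ 0}, G, ⟨?_, ?_, hGs.mono inter_subset_left,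
    fun y hy => hGh y hy.1, fun y hy => hy.2, ?_, ?_⟩, ⟨hq0, hpW⟩, ?_⟩
  · exact hdc.isOpen_inter_preimage hW₁ isOpen_ne
  · rintro y ⟨hy, hy'⟩ t ht
    refine ⟨hW₁s y hy t ht, ?_⟩
    change fderiv ℝ G (t • y) ≠ 0
    rw [fderiv_smul_of_homogeneous hW₁ hW₁s (hGs.differentiableOn (by simp)) hGh hy ht]
    exact smul_ne_zero (inv_ne_zero ht.ne') hy'
  · rintro y ⟨⟨hy0, hyW⟩, -⟩ hyf
    obtain ⟨h1, h2⟩ := hfront y hy0 hyf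
    refine le_antisymm (not_lt.1 fun hpos => ?_) (not_lt.1 fun hneg => h2 ?_)
    · obtain ⟨z, ⟨hzg, hzW⟩, hzU⟩ := mem_closure_iff_nhds.1 h1 ({z | 0 < g z} ∩ W)
        (Filter.inter_mem ((isOpen_lt continuous_const hg.continuous).mem_nhds hpos)
          (hW.mem_nhds hyW))
      have : z ∈ U ∩ W := ⟨hzU, hzW⟩
      rw [hUW] at this
      exact lt_asymm hzg this.2.2
    · have : radial y ∈ U ∩ W := by
        rw [hUW]
        exact ⟨hDs h1, hyW, hneg⟩
      exact this.1
  · rintro y ⟨⟨hy0, hyW⟩, -⟩ hneg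
    have : radial y ∈ U ∩ W := by
      rw [hUW]
      exact ⟨mem_sphere_zero_iff_norm.2 (norm_radial hy0), hyW, hneg⟩
    exact ⟨coneOver_radial hy0 (subset_closure this.1), hy0⟩
  -- The vector `v` tangent to the sphere at `radial q` is orthogonal to `q`; along it `G` has
  -- derivative `‖q‖⁻¹` times that of `g`, which is nonzero.
  · intro h0
    have hqv : ⟪q, v⟫ = 0 := by
      rw [← norm_smul_radial hq0, real_inner_smul_left, hv, mul_zero]
    have hgd : HasFDerivAt g (fderiv ℝ g (radial q)) (radial (q + (0 : ℝ) • v)) := by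
      rw [zero_smul, add_zero]
      exact (hg.differentiable (by simp) _).hasFDerivAt
    have h1 := hgd.comp_hasDerivAt (0 : ℝ) (hasDerivAt_radial_line hq0 hqv)
    have hGd : HasFDerivAt G (fderiv ℝ G q) (q + (0 : ℝ) • v) := by
      rw [zero_smul, add_zero]
      exact ((hGs.differentiableOn (by simp)).differentiableAt
        (hW₁.mem_nhds ⟨hq0, hpW⟩)).hasFDerivAt
    have hline : HasDerivAt (fun s : ℝ => q + s • v) v 0 := by
      simpa using ((hasDerivAt_id (0 : ℝ)).smul_const v).const_add q
    have h2 := hGd.comp_hasDerivAt (0 : ℝ) hline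
    have h3 := h1.unique h2
    rw [h0] at h3
    simp [hgv, hq0] at h3

/-- At a frontier point every `v` with dG(v) < 0 points into the cone, so the tangent cone contains
a nonempty open half-space and spans. This makes derivatives of the density well determined up to
the boundary. -/
lemma uniqueDiffOn_punctured (hM : IsSolidCone M) : UniqueDiffOn ℝ (punctured M) := by
  intro q hq
  by_cases hqi : q ∈ interior M
  · refine uniqueDiffWithinAt_of_mem_nhds ?_
    exact Filter.inter_mem (mem_interior_iff_mem_nhds.1 hqi) (isOpen_compl_singleton.mem_nhds hq.2)
  have hqf : q ∈ frontier M := ⟨subset_closure hq.1, hqi⟩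
  obtain ⟨W, G, hG, hqW⟩ := exists_definingFunction hM hq hqf
  have hdiff : HasFDerivAt G (fderiv ℝ G q) q :=
    ((hG.smooth.differentiableOn (by simp)).differentiableAt (hG.isOpen.mem_nhds hqW)).hasFDerivAt
  have hsub : {v | fderiv ℝ G q v < 0} ⊆ tangentConeAt ℝ (punctured M) q := by
    intro v hv
    -- It suffices that q + 2⁻ᵏ v lies in the cone for all large k, which holds since `G` vanishes
    -- at `q` and decreases along `v`.
    refine mem_tangentConeAt_of_pow_smul (r := 1 / 2) (by norm_num) (by norm_num) ?_
    have hline : HasDerivAt (fun s : ℝ => q + s • v) v 0 := by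
      simpa using ((hasDerivAt_id (0 : ℝ)).smul_const v).const_add q
    have h1 : HasDerivAt (fun s : ℝ => G (q + s • v)) (fderiv ℝ G q v) 0 := by
      have h0 : HasFDerivAt G (fderiv ℝ G q) (q + (0 : ℝ) • v) := by
        rwa [zero_smul, add_zero]
      exact h0.comp_hasDerivAt (0 : ℝ) hline
    have hneg : ∀ᶠ s in nhdsWithin (0 : ℝ) (Ioi 0), G (q + s • v) < 0 := by
      have h2 := hasDerivAt_iff_tendsto_slope.1 h1
      have h3 := h2.eventually (gt_mem_nhds hv)
      have h4 : ∀ᶠ s in nhdsWithin (0 : ℝ) (Ioi 0), slope (fun s : ℝ => G (q + s • v)) 0 s < 0 :=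
        nhdsWithin_mono 0 (fun s hs => ne_of_gt hs) h3
      filter_upwards [h4, self_mem_nhdsWithin] with s hs hs0
      rw [slope_def_field] at hs
      simp only [zero_smul, add_zero, sub_zero, hG.frontier q hqW hqf] at hs
      have hs0' : 0 < s := hs0
      exact (div_neg_iff.1 hs).elim (fun h => absurd h.2 (not_lt.2 hs0'.le)) (fun h => h.1)
    have hWe : ∀ᶠ s in nhdsWithin (0 : ℝ) (Ioi 0), q + s • v ∈ W := by
      refine mem_nhdsWithin_of_mem_nhds (hline.continuousAt.preimage_mem_nhds ?_)
      rw [zero_smul, add_zero]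
      exact hG.isOpen.mem_nhds hqW
    have hpow : Filter.Tendsto (fun k : ℕ => (1 / 2 : ℝ) ^ k) Filter.atTop
        (nhdsWithin (0 : ℝ) (Ioi 0)) :=
      tendsto_nhdsWithin_iff.2 ⟨tendsto_pow_atTop_nhds_zero_of_lt_one (by norm_num) (by norm_num),
        Filter.Eventually.of_forall fun k => by simp only [mem_Ioi]; positivity⟩
    filter_upwards [hpow.eventually hneg, hpow.eventually hWe] with k h1 h2
    exact hG.neg _ h2 h1
  obtain ⟨v, hv⟩ : ∃ v, fderiv ℝ G q v < 0 := by
    by_contra! h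
    refine hG.fderiv_ne q hqW (ContinuousLinearMap.ext fun v => le_antisymm ?_ (h v))
    simpa using h (-v)
  refine ⟨?_, subset_closure hq⟩
  have htop : Submodule.span ℝ (tangentConeAt ℝ (punctured M) q) = ⊤ := by
    refine Submodule.eq_top_of_nonempty_interior' _ ⟨v, ?_⟩
    refine mem_interior.2 ⟨_, hsub.trans Submodule.subset_span, ?_, hv⟩
    exact isOpen_lt (fderiv ℝ G q).continuous continuous_const
  rw [htop]
  exact dense_univ

/-- The derivative of a function along the radial direction. -/
lemma radial_derivative (hM : IsSolidCone M) {F : Type*} [NormedAddCommGroup F] [NormedSpace ℝ F]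
    {A : E n → F} {A' : E n →L[ℝ] F} {y : E n}
    (hy : y ∈ punctured M) (hA : HasFDerivWithinAt A A' (punctured M) y) {c : ℝ → F} {c' : F}
    (hc : ∀ t : ℝ, 0 < t → A (t • y) = c t) (hc' : HasDerivAt c c' 1) : A' y = c' := by
  have hray : HasDerivWithinAt (fun t : ℝ => t • y) y (Ioi 0) 1 := by
    simpa using ((hasDerivAt_id (1 : ℝ)).smul_const y).hasDerivWithinAt
  have hA1 : HasFDerivWithinAt A A' (punctured M) ((1 : ℝ) • y) := by rwa [one_smul]
  have h1 := hA1.comp_hasDerivWithinAt (1 : ℝ) hray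
    (fun t ht => smul_mem_punctured hM ht hy)
  have h2 : HasDerivWithinAt c (A' y) (Ioi 0) 1 :=
    h1.congr (fun t ht => (hc t ht).symm) (hc 1 one_pos).symm
  exact (uniqueDiffWithinAt_of_mem_nhds (Ioi_mem_nhds one_pos)).eq_deriv _ h2 hc'.hasDerivWithinAt

variable {k : ℝ} {f : E n → ℝ}

lemma contDiffOn_log (hf : IsHomogeneousDensity M k f) :
    ContDiffOn ℝ ∞ (fun x => Real.log (f x)) (punctured M) :=
  hf.smooth.log fun x hx => (hf.pos x hx).ne'

/-- The differential of the logarithm of the density. -/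
def logFDeriv (M : Set (E n)) (f : E n → ℝ) : E n → E n →L[ℝ] ℝ :=
  fderivWithin ℝ (fun x => Real.log (f x)) (punctured M)

lemma hasFDerivWithinAt_log (hf : IsHomogeneousDensity M k f) {q : E n} (hq : q ∈ punctured M) :
    HasFDerivWithinAt (fun x => Real.log (f x)) (logFDeriv M f q) (punctured M) q :=
  ((contDiffOn_log hf).differentiableOn (by simp) q hq).hasFDerivWithinAt

lemma inner_gradLog (q w : E n) : ⟪gradLog M f q, w⟫ = logFDeriv M f q w := by
  rw [gradLog, gradientWithin, InnerProductSpace.toDual_symm_apply]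
  rfl

lemma log_smul (hf : IsHomogeneousDensity M k f) {q : E n} (hq : q ∈ punctured M) {t : ℝ}
    (ht : 0 < t) : Real.log (f (t • q)) = k * Real.log t + Real.log (f q) := by
  rw [hf.homogeneous t ht q hq, Real.log_mul (Real.rpow_pos_of_pos ht k).ne' (hf.pos q hq).ne',
    Real.log_rpow ht]

/-- Euler's identity: differentiate log f(tq) = k log t + log f(q) at t = 1. -/
lemma logFDeriv_self (hM : IsSolidCone M) (hf : IsHomogeneousDensity M k f) {q : E n}
    (hq : q ∈ punctured M) : logFDeriv M f q q = k := by
  refine radial_derivative hM hq (hasFDerivWithinAt_log hf hq)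
    (c := fun t => k * Real.log t + Real.log (f q)) (fun t ht => log_smul hf hq ht) ?_
  simpa using ((Real.hasDerivAt_log one_ne_zero).const_mul k).add_const (Real.log (f q))

lemma logFDeriv_smul (hM : IsSolidCone M) (hf : IsHomogeneousDensity M k f) {q : E n}
    (hq : q ∈ punctured M) {t : ℝ} (ht : 0 < t) :
    logFDeriv M f (t • q) = t⁻¹ • logFDeriv M f q := by
  have h1 := hasFDerivWithinAt_log hf (smul_mem_punctured hM ht hq)
  have h2 : HasFDerivWithinAt (fun z : E n => t • z) (t • ContinuousLinearMap.id ℝ (E n))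
      (punctured M) q := ((hasFDerivAt_id q).const_smul t).hasFDerivWithinAt
  have h3 := HasFDerivWithinAt.comp q h1 h2 (fun z hz => smul_mem_punctured hM ht hz)
  have h4 : HasFDerivWithinAt (fun z => k * Real.log t + Real.log (f z)) (logFDeriv M f q)
      (punctured M) q := (hasFDerivWithinAt_log hf hq).const_add _
  have h5 := h4.congr (fun z hz => log_smul hf hz ht) (log_smul hf hq ht)
  have h6 := uniqueDiffOn_punctured hM q hq |>.eq h3 h5
  rw [← h6]
  ext v
  simp [ht.ne']

lemma logFDeriv_contDiffOn (hM : IsSolidCone M) (hf : IsHomogeneousDensity M k f) :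
    ContDiffOn ℝ ∞ (logFDeriv M f) (punctured M) :=
  (contDiffOn_log hf).fderivWithin (uniqueDiffOn_punctured hM) (by simp)

end Cone

/-! ### The Minkowski formula -/

section Minkowski

variable {n : ℕ} [NeZero n] {S : Type*} [TopologicalSpace S]
  [ChartedSpace (EuclideanHalfSpace n) S] [IsManifold (𝓡∂ n) ∞ S] {φ N : S → E n}
  {M : Set (E n)} {k : ℝ} {f : E n → ℝ}

lemma mem_boundary_of_chart {x : S} {u : Coord n} (hu : u ∈ (extChartAt (𝓡∂ n) x).target)
    (hu0 : u 0 = 0) : (extChartAt (𝓡∂ n) x).symm u ∈ (𝓡∂ n).boundary S := by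
  have hsrc : (extChartAt (𝓡∂ n) x).symm u ∈ (chartAt (EuclideanHalfSpace n) x).source := by
    rw [← extChartAt_source (𝓡∂ n)]
    exact (extChartAt (𝓡∂ n) x).map_target hu
  refine (ModelWithCorners.isBoundaryPoint_iff_of_mem_atlas (I := 𝓡∂ n) (n := ∞) (by simp)
    (chart_mem_atlas (EuclideanHalfSpace n) x) hsrc).2 ?_
  have h : (chartAt (EuclideanHalfSpace n) x).extend (𝓡∂ n) ((extChartAt (𝓡∂ n) x).symm u) = u :=
    (extChartAt (𝓡∂ n) x).right_inv hu
  rw [h]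
  refine ⟨subset_closure hu, fun hi => ?_⟩
  have h2 : u ∈ interior (range (𝓡∂ n)) := interior_mono (extChartAt_target_subset_range x) hi
  rw [interior_range_modelWithCornersEuclideanHalfSpace] at h2
  exact (ne_of_gt h2) hu0

omit [NeZero n] in
lemma IsDefiningFunction.differentiableAt {W : Set (E n)} {G : E n → ℝ}
    (hG : IsDefiningFunction M W G) {q : E n} (hq : q ∈ W) : HasFDerivAt G (fderiv ℝ G q) q :=
  ((hG.smooth.differentiableOn (by simp)).differentiableAt (hG.isOpen.mem_nhds hq)).hasFDerivAt

-- `G` is zero on the frontier near `q`, so its differential kills the tangent cone of the frontier.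
-- This turns the orthogonality hypothesis into dG(N) = 0.
omit [NeZero n] in
lemma IsDefiningFunction.gradient_mem_normalSpace {W : Set (E n)} {G : E n → ℝ}
    (hG : IsDefiningFunction M W G) {q : E n} (hq : q ∈ W) (hqf : q ∈ _root_.frontier M) :
    (InnerProductSpace.toDual ℝ (E n)).symm (fderiv ℝ G q) ∈ normalSpace (_root_.frontier M) q := by
  intro v hv
  rw [InnerProductSpace.toDual_symm_apply]
  have h1 := (hG.differentiableAt hq).hasFDerivWithinAt (s := _root_.frontier M)
  have h2 : HasFDerivWithinAt G (0 : E n →L[ℝ] ℝ) (_root_.frontier M) q := by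
    refine (hasFDerivWithinAt_const (0 : ℝ) q _).congr_of_eventuallyEq ?_ (hG.frontier q hq hqf)
    filter_upwards [self_mem_nhdsWithin, mem_nhdsWithin_of_mem_nhds (hG.isOpen.mem_nhds hq)]
      with y hy hyW
    exact hG.frontier y hyW hy
  exact h1.unique_on h2 hv

/-- At boundary points the tangential part of the position vector is tangent to the boundary. -/
lemma tangential_position_boundary (hM : IsSolidCone M) (hφ : IsSmoothImmersion φ)
    (hφM : ∀ p, φ p ∈ punctured M)
    (hbd : ∀ p ∈ (𝓡∂ n).boundary S, φ p ∈ frontier M)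
    (horth : ∀ p ∈ (𝓡∂ n).boundary S, ∀ ξ ∈ normalSpace (frontier M) (φ p), ⟪N p, ξ⟫ = 0)
    {x : S} {u : Coord n} (hu : u ∈ (extChartAt (𝓡∂ n) x).target) (hu0 : u 0 = 0)
    {P : E n →L[ℝ] Coord n}
    (hP : ∀ y, chartFDeriv φ x u (P y) = y - ⟪y, inChart N x u⟫ • inChart N x u) :
    P (inChart φ x u) 0 = 0 := by
  have hpb := mem_boundary_of_chart hu hu0
  set q := inChart φ x u
  have hqf : q ∈ frontier M := hbd _ hpb
  have hqM : q ∈ punctured M := hφM _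
  obtain ⟨W, G, hG, hqW⟩ := exists_definingFunction hM hqM hqf
  set D := fderiv ℝ G q
  have hD := hG.differentiableAt hqW
  have hDν : D (inChart N x u) = 0 := by
    have h := horth _ hpb _ (hG.gradient_mem_normalSpace hqW hqf)
    rw [real_inner_comm, InnerProductSpace.toDual_symm_apply] at h
    exact h
  have hDq : D q = 0 := radial_derivative hM hqM hD.hasFDerivWithinAt (c := fun _ => G q)
    (fun t ht => hG.homogeneous q hqW t ht) (hasDerivAt_const _ _)
  -- The differential of G ∘ φ kills `coordVec j` for `j ≠ 0`, because the boundary face is mapped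
  -- into ∂M where `G` vanishes. It also kills `P X`, because dG kills both X and N. Being nonzero,
  -- it is a multiple of the coordinate 0, so that coordinate of `P X` is zero.
  let ℓ : Coord n →L[ℝ] ℝ := D.comp (chartFDeriv φ x u)
  have hℓP : ∀ y, ℓ (P y) = D y := fun y => by simp [ℓ, hP, hDν]
  have hΦ := inChart_hasFDerivWithinAt hφ.1 hu
  have hℓ : HasFDerivWithinAt (G ∘ inChart φ x) ℓ (range (𝓡∂ n)) u := hD.comp_hasFDerivWithinAt u hΦ
  have hℓj : ∀ j, j ≠ 0 → ℓ (coordVec j) = 0 := by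
    intro j hj
    have hline : HasDerivAt (fun s : ℝ => u + s • coordVec j) (coordVec j) 0 := by
      simpa using ((hasDerivAt_id (0 : ℝ)).smul_const (coordVec j)).const_add u
    have hline0 : ∀ s : ℝ, (u + s • coordVec j) 0 = 0 := fun s => by
      simp [hu0, Ne.symm hj]
    have hlineH : ∀ s : ℝ, u + s • coordVec j ∈ range (𝓡∂ n) := fun s => by
      rw [range_modelWithCornersEuclideanHalfSpace]
      exact (hline0 s).ge
    have h0 : HasFDerivWithinAt (G ∘ inChart φ x) ℓ (range (𝓡∂ n)) (u + (0 : ℝ) • coordVec j) := by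
      rwa [zero_smul, add_zero]
    have h1 := h0.comp_hasDerivAt (0 : ℝ) hline (Filter.Eventually.of_forall hlineH)
    have h2 : Filter.Tendsto (fun s : ℝ => u + s • coordVec j) (nhds 0)
        (nhdsWithin u (range (𝓡∂ n))) := by
      refine tendsto_nhdsWithin_iff.2 ⟨?_, Filter.Eventually.of_forall hlineH⟩
      have := hline.continuousAt.tendsto
      simpa using this
    have h3 : ∀ᶠ s in nhds (0 : ℝ), ((G ∘ inChart φ x) ∘ fun s : ℝ => u + s • coordVec j) s = 0 := by
      filter_upwards [h2.eventually (target_mem_nhdsWithin hu),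
        h2.eventually (hΦ.continuousWithinAt.preimage_mem_nhdsWithin (hG.isOpen.mem_nhds hqW))]
        with s hs hsW
      exact hG.frontier _ hsW (hbd _ (mem_boundary_of_chart hs (hline0 s)))
    exact (h1.congr_of_eventuallyEq (f₁ := fun _ => (0 : ℝ)) (h3.mono fun s hs => hs.symm)).unique
      (hasDerivAt_const _ _)
  have hℓv : ∀ v : Coord n, ℓ v = v 0 * ℓ (coordVec 0) := by
    intro v
    rw [map_eq_sum_coordVec ℓ v, Finset.sum_eq_single 0]
    · rfl
    · intro j _ hj
      rw [hℓj j hj, smul_zero]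
    · simp
  have hℓ0 : ℓ (coordVec 0) ≠ 0 := by
    intro h0
    -- dG kills N, so if it also killed the tangent hyperplane it would be zero.
    refine hG.fderiv_ne q hqW (ContinuousLinearMap.ext fun y => ?_)
    have := hℓP y
    rw [hℓv, h0, mul_zero] at this
    exact this.symm
  have h := hℓP q
  rw [hℓv, hDq] at h
  exact (mul_eq_zero.1 h).resolve_right hℓ0

/-- The volume of the frame in the chart at `x`. -/
def chartVol (φ N : S → E n) (x : S) (u : Coord n) : ℝ :=
  volForm n (frame (chartFDeriv φ x u) (inChart N x u))

/-- The tangential part of the position vector in the chart at `x`, multiplied by `chartVol`. -/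
def chartField (φ N : S → E n) (x : S) (u : Coord n) : Coord n :=
  cramerField (chartFDeriv φ x u) (inChart N x u) (inChart φ x u)

lemma frame_contDiffWithinAt (hφ : IsSmoothImmersion φ) (hN : IsUnitNormal φ N) {x : S}
    {u : Coord n} (hu : u ∈ (extChartAt (𝓡∂ n) x).target) (b : Fin (n + 1)) :
    ContDiffWithinAt ℝ ∞ (fun v => frame (chartFDeriv φ x v) (inChart N x v) b)
      (range (𝓡∂ n)) u := by
  refine Fin.cases ?_ (fun j => ?_) b
  · exact inChart_contDiffWithinAt hN.smooth hu
  · exact (chartFDeriv_contDiffWithinAt hφ.1 hu).clm_apply contDiffWithinAt_const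

omit [NeZero n] in
lemma volForm_contDiffWithinAt {m : Coord n → Fin (n + 1) → E n} {s : Set (Coord n)} {u : Coord n}
    (hm : ∀ b, ContDiffWithinAt ℝ ∞ (fun v => m v b) s u) :
    ContDiffWithinAt ℝ ∞ (fun v => volForm n (m v)) s u :=
  ((volForm n).toContinuousMultilinearMap.contDiff.contDiffAt).comp_contDiffWithinAt u
    (contDiffWithinAt_pi.2 hm)

lemma chartVol_contDiffWithinAt (hφ : IsSmoothImmersion φ) (hN : IsUnitNormal φ N) {x : S}
    {u : Coord n} (hu : u ∈ (extChartAt (𝓡∂ n) x).target) :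
    ContDiffWithinAt ℝ ∞ (chartVol φ N x) (range (𝓡∂ n)) u :=
  volForm_contDiffWithinAt (frame_contDiffWithinAt hφ hN hu)

lemma chartField_contDiffWithinAt (hφ : IsSmoothImmersion φ) (hN : IsUnitNormal φ N) {x : S}
    {u : Coord n} (hu : u ∈ (extChartAt (𝓡∂ n) x).target) :
    ContDiffWithinAt ℝ ∞ (chartField φ N x) (range (𝓡∂ n)) u := by
  refine contDiffWithinAt_euclidean.2 fun i => volForm_contDiffWithinAt fun b => ?_
  by_cases hb : b = Fin.succ i
  · subst hb
    simpa using inChart_contDiffWithinAt hφ.1 hu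
  · simpa [hb] using frame_contDiffWithinAt hφ hN hu b

lemma chartVol_ne_zero (hφ : IsSmoothImmersion φ) (hN : IsUnitNormal φ N) {x : S}
    {u : Coord n} (hu : u ∈ (extChartAt (𝓡∂ n) x).target) : chartVol φ N x u ≠ 0 := by
  have h := volForm_frame_sq (hN.norm_eq_one _) (inner_chartFDeriv_normal hφ hN hu)
  intro h0
  have h1 : volForm n (frame (chartFDeriv φ x u) (N ((extChartAt (𝓡∂ n) x).symm u))) = 0 := h0
  rw [h1] at h
  exact (isUnit_det_gramMatrix (chartFDeriv_injective hφ hu)).ne_zero (by rw [← h]; norm_num)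

/-- The density √g equals sign(vol) · vol. A nonvanishing volume has locally constant sign, which is
therefore differentiated as a constant; no orientation of the charts is needed. -/
lemma eventually_sign_chartVol (hφ : IsSmoothImmersion φ) (hN : IsUnitNormal φ N) {x : S}
    {u : Coord n} (hu : u ∈ (extChartAt (𝓡∂ n) x).target) :
    ∀ᶠ v in nhdsWithin u (range (𝓡∂ n)),
      Real.sign (chartVol φ N x v) = Real.sign (chartVol φ N x u) := by
  have hc : ContinuousWithinAt (chartVol φ N x) (range (𝓡∂ n)) u :=
    (chartVol_contDiffWithinAt hφ hN hu).continuousWithinAt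
  rcases lt_or_gt_of_ne (chartVol_ne_zero hφ hN hu) with h | h
  · filter_upwards [hc.eventually_lt_const h] with v hv
    rw [Real.sign_of_neg hv, Real.sign_of_neg h]
  · filter_upwards [hc.eventually_const_lt h] with v hv
    rw [Real.sign_of_pos hv, Real.sign_of_pos h]

lemma density_contDiffWithinAt (hf : IsHomogeneousDensity M k f) (hφ : IsSmoothImmersion φ)
    (hφM : ∀ p, φ p ∈ punctured M) {x : S} {u : Coord n}
    (hu : u ∈ (extChartAt (𝓡∂ n) x).target) :
    ContDiffWithinAt ℝ ∞ (fun v => f (inChart φ x v)) (range (𝓡∂ n)) u :=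
  (hf.smooth (inChart φ x u) (hφM _)).comp u (inChart_contDiffWithinAt hφ.1 hu)
    (fun _ _ => hφM _)

open Classical in
/-- The field `ρ f X^T √g` in the chart at `x`, extended by zero. -/
def testField (f : E n → ℝ) (φ N : S → E n) (ρ : S → ℝ) (x : S) (u : Coord n) : Coord n :=
  if u ∈ (extChartAt (𝓡∂ n) x).target then
    (Real.sign (chartVol φ N x u) * (inChart ρ x u * f (inChart φ x u))) • chartField φ N x u
  else 0

omit [IsManifold (𝓡∂ n) ∞ S] in
lemma testField_eq_zero {ρ : S → ℝ} {x : S} {u : Coord n}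
    (hu : u ∉ extChartAt (𝓡∂ n) x '' tsupport ρ) : testField f φ N ρ x u = 0 := by
  rw [testField]
  split_ifs with h
  · have : inChart ρ x u = 0 := by
      by_contra h0
      exact hu ⟨(extChartAt (𝓡∂ n) x).symm u, subset_closure h0, (extChartAt (𝓡∂ n) x).right_inv h⟩
    rw [this, zero_mul, mul_zero, zero_smul]
  · rfl

lemma testField_eventuallyEq (hφ : IsSmoothImmersion φ) (hN : IsUnitNormal φ N) {ρ : S → ℝ} {x : S}
    {u : Coord n} (hu : u ∈ (extChartAt (𝓡∂ n) x).target) :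
    testField f φ N ρ x =ᶠ[nhdsWithin u (range (𝓡∂ n))] fun v =>
      (Real.sign (chartVol φ N x u) * (inChart ρ x v * f (inChart φ x v))) • chartField φ N x v := by
  filter_upwards [target_mem_nhdsWithin hu, eventually_sign_chartVol hφ hN hu] with v hv hs
  rw [testField, if_pos hv, hs]

omit [IsManifold (𝓡∂ n) ∞ S] in
lemma isCompact_chart_tsupport [CompactSpace S] {ρ : S → ℝ} {x : S}
    (hρx : tsupport ρ ⊆ (extChartAt (𝓡∂ n) x).source) :
    IsCompact (extChartAt (𝓡∂ n) x '' tsupport ρ) :=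
  (isClosed_tsupport ρ).isCompact.image_of_continuousOn ((continuousOn_extChartAt x).mono hρx)

lemma testField_contDiffOn [CompactSpace S] (hf : IsHomogeneousDensity M k f)
    (hφ : IsSmoothImmersion φ)
    (hφM : ∀ p, φ p ∈ punctured M) (hN : IsUnitNormal φ N) {ρ : S → ℝ}
    (hρ : ContMDiff (𝓡∂ n) 𝓘(ℝ, ℝ) ∞ ρ) {x : S}
    (hρx : tsupport ρ ⊆ (extChartAt (𝓡∂ n) x).source) :
    ContDiffOn ℝ 1 (testField f φ N ρ x) (range (𝓡∂ n)) := by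
  intro u huH
  by_cases hu : u ∈ (extChartAt (𝓡∂ n) x).target
  · have h : ContDiffWithinAt ℝ ∞ (fun v => (Real.sign (chartVol φ N x u) *
        (inChart ρ x v * f (inChart φ x v))) • chartField φ N x v) (range (𝓡∂ n)) u :=
      (contDiffWithinAt_const.mul ((inChart_contDiffWithinAt hρ hu).mul
        (density_contDiffWithinAt hf hφ hφM hu))).smul (chartField_contDiffWithinAt hφ hN hu)
    refine (h.congr_of_eventuallyEq (testField_eventuallyEq hφ hN hu) ?_).of_le (by simp)
    rw [testField, if_pos hu]
  · have huK : u ∉ extChartAt (𝓡∂ n) x '' tsupport ρ := by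
      rintro ⟨p, hp, rfl⟩
      exact hu ((extChartAt (𝓡∂ n) x).map_source (hρx hp))
    have h : testField f φ N ρ x =ᶠ[nhdsWithin u (range (𝓡∂ n))] fun _ => 0 := by
      filter_upwards [mem_nhdsWithin_of_mem_nhds
        ((isCompact_chart_tsupport hρx).isClosed.isOpen_compl.mem_nhds huK)] with v hv
      exact testField_eq_zero hv
    exact contDiffWithinAt_const.congr_of_eventuallyEq h (testField_eq_zero huK)

/-- The divergence of `ρ X^T` with respect to the weighted area, where `V` is the vector field on
the hypersurface that represents `X^T`. -/
def weightedDiv (M : Set (E n)) (k : ℝ) (f : E n → ℝ) (φ N : S → E n) (V : S → Coord n) (ρ : S → ℝ)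
    (p : S) : ℝ :=
  ρ p * (n + k + meanCurvature M f φ N p * ⟪φ p, N p⟫) + manifoldFDeriv ρ p (V p)

lemma halfSpace_mem_nhds {u : Coord n} (hu : 0 < u 0) : range (𝓡∂ n) ∈ nhds u := by
  rw [← mem_interior_iff_mem_nhds, interior_range_modelWithCornersEuclideanHalfSpace]
  exact hu

/-- Second derivatives of a smooth map in a chart, at interior points. -/
lemma exists_second_derivative (hφ : IsSmoothImmersion φ) {x : S} {u : Coord n}
    (hu : u ∈ (extChartAt (𝓡∂ n) x).target) (hu0 : 0 < u 0) :
    ∃ L' : Coord n →L[ℝ] Coord n →L[ℝ] E n, HasFDerivAt (chartFDeriv φ x) L' u ∧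
      ∀ v w, L' v w = L' w v := by
  have hHn := halfSpace_mem_nhds hu0
  have h1 : ContDiffAt ℝ ∞ (inChart φ x) u := (inChart_contDiffWithinAt hφ.1 hu).contDiffAt hHn
  have h2 : HasFDerivAt (chartFDeriv φ x) (fderiv ℝ (chartFDeriv φ x) u) u :=
    (((chartFDeriv_contDiffWithinAt hφ.1 hu).contDiffAt hHn).differentiableAt (by simp)).hasFDerivAt
  have h3 : chartFDeriv φ x =ᶠ[nhds u] fderiv ℝ (inChart φ x) := by
    filter_upwards [eventually_mem_nhds_iff.2 hHn] with v hv
    exact fderivWithin_of_mem_nhds hv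
  refine ⟨_, h2, ?_⟩
  rw [h3.fderiv_eq]
  exact h1.isSymmSndFDerivAt (by simp only [minSmoothness_of_isRCLikeNormedField]; exact WithTop.coe_le_coe.2 (le_top : (2 : ℕ∞) ≤ ⊤))

/-- Product rule: √g X^T contributes n - ⟨X,N⟩ div N, the density contributes k - ⟨X,N⟩⟨∇ψ,N⟩ by
Euler's identity, and the cutoff contributes dρ(X^T). The first two add up to n + k + H_f⟨X,N⟩. -/
lemma coordDiv_testField (hM : IsSolidCone M) (hf : IsHomogeneousDensity M k f)
    (hφ : IsSmoothImmersion φ)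
    (hφM : ∀ p, φ p ∈ punctured M) (hN : IsUnitNormal φ N) {V : S → Coord n}
    (hV : ∀ p, manifoldFDeriv φ p (V p) = φ p - ⟪φ p, N p⟫ • N p) {ρ : S → ℝ}
    (hρ : ContMDiff (𝓡∂ n) 𝓘(ℝ, ℝ) ∞ ρ) {x : S} {u : Coord n}
    (hu : u ∈ (extChartAt (𝓡∂ n) x).target) (hu0 : 0 < u 0) :
    coordDiv (testField f φ N ρ x) u = chartAreaDensity φ x u *
      (f (inChart φ x u) * inChart (weightedDiv M k f φ N V ρ) x u) := by
  have hHn := halfSpace_mem_nhds hu0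
  set p := (extChartAt (𝓡∂ n) x).symm u
  set L := chartFDeriv φ x u
  have hLinj : Function.Injective L := chartFDeriv_injective hφ hu
  have hLν := inner_chartFDeriv_normal hφ hN hu
  have hNu : ∀ v, ⟪chartFDeriv N x u v, N p⟫ = 0 := inner_chartFDeriv_normal_self hN hu
  obtain ⟨P, hP⟩ := exists_tangential_leftInverse hLinj (hN.norm_eq_one p) hLν
  have hΦ : HasFDerivAt (inChart φ x) L u := (inChart_hasFDerivWithinAt hφ.1 hu).hasFDerivAt hHn
  have hν : HasFDerivAt (inChart N x) (chartFDeriv N x u) u :=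
    (inChart_hasFDerivWithinAt hN.smooth hu).hasFDerivAt hHn
  have hρd : HasFDerivAt (inChart ρ x) (chartFDeriv ρ x u) u :=
    (inChart_hasFDerivWithinAt hρ hu).hasFDerivAt hHn
  obtain ⟨L', hL', hsymm⟩ := exists_second_derivative hφ hu hu0
  obtain ⟨w', hw', hsum⟩ := exists_hasFDerivAt_cramerField (L := chartFDeriv φ x) hΦ hL' hν hsymm
    hNu hP
  change HasFDerivAt (chartField φ N x) w' u at hw'
  have hpos : ∀ v : Coord n, 0 < f (inChart φ x v) := fun v => hf.pos _ (hφM _)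
  have hfd : HasFDerivAt (fun v => f (inChart φ x v))
      (f (inChart φ x u) • (logFDeriv M f (φ p)).comp L) u := by
    have h1 := (hasFDerivWithinAt_log hf (hφM p)).comp u (hΦ.hasFDerivWithinAt (s := univ))
      (fun v _ => hφM _)
    have h2 := (hasFDerivWithinAt_univ.1 h1).exp
    have h3 : (fun v : Coord n => Real.exp (((fun y => Real.log (f y)) ∘ inChart φ x) v))
        = fun v => f (inChart φ x v) := by
      ext1 v
      exact Real.exp_log (hpos v)
    rw [h3] at h2
    have h4 : Real.exp (((fun y => Real.log (f y)) ∘ inChart φ x) u) = f (inChart φ x u) :=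
      Real.exp_log (hpos u)
    rwa [h4] at h2
  set σ := Real.sign (chartVol φ N x u)
  have hamp := (hρd.mul hfd).const_mul σ
  have hW := hamp.smul hw'
  have heq := testField_eventuallyEq (f := f) hφ hN (ρ := ρ) hu
  rw [nhdsWithin_eq_nhds.2 hHn] at heq
  have hfw : fderivWithin ℝ (testField f φ N ρ x) (range (𝓡∂ n)) u = _ :=
    (fderivWithin_of_mem_nhds hHn).trans (hW.congr_of_eventuallyEq heq).fderiv
  have hcr := cramerField_eq hP (inChart φ x u)
  have hsd := surfaceDiv_eq_gramDiv hφ hN hu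
  rw [gramDiv_eq_trace hLinj hP hNu] at hsd
  -- `P X` and `V p` represent the same tangent vector in two frames, by injectivity of dφ.
  have hVP : chartFDeriv ρ x u (P (inChart φ x u)) = manifoldFDeriv ρ p (V p) := by
    have h1 : L (P (inChart φ x u)) = manifoldFDeriv φ p (V p) := by rw [hP, hV]; rfl
    have h2 : L = (manifoldFDeriv φ p).comp (chartFrame x u) :=
      chartFDeriv_eq (hφ.1.mdifferentiable (by simp)) hu
    rw [h2] at h1
    have h3 : chartFrame x u (P (inChart φ x u)) = V p := hφ.2 p h1
    rw [chartFDeriv_eq (hρ.mdifferentiable (by simp)) hu, ContinuousLinearMap.comp_apply, h3]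
  have hlog : logFDeriv M f (φ p) (L (P (inChart φ x u)))
      = k - ⟪φ p, N p⟫ * ⟪gradLog M f (φ p), N p⟫ := by
    rw [hP, map_sub, map_smul, inner_gradLog]
    have h1 : logFDeriv M f (φ p) (inChart φ x u) = k := logFDeriv_self hM hf (hφM p)
    rw [h1]
    rfl
  have habs : chartAreaDensity φ x u = σ * chartVol φ N x u := by
    rw [chartAreaDensity_eq hφ hN hu]
    change |chartVol φ N x u| = _
    rcases lt_or_gt_of_ne (chartVol_ne_zero hφ hN hu) with h | h
    · simp only [σ]; rw [Real.sign_of_neg h, abs_of_neg h]; ring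
    · simp only [σ]; rw [Real.sign_of_pos h, abs_of_pos h]; ring
  have hcd : coordDiv (testField f φ N ρ x) u
      = (σ * (inChart ρ x u * f (inChart φ x u))) * ∑ i, w' (coordVec i) i
        + σ * (inChart ρ x u * (f (inChart φ x u) * logFDeriv M f (φ p) (L (chartField φ N x u)))
          + f (inChart φ x u) * chartFDeriv ρ x u (chartField φ N x u)) := by
    rw [coordDiv, hfw]
    have hsc : ∀ ℓ : Coord n →L[ℝ] ℝ, ℓ (chartField φ N x u)
        = ∑ i, ℓ (coordVec i) * chartField φ N x u i := fun ℓ => by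
      rw [map_eq_sum_coordVec ℓ]
      exact Finset.sum_congr rfl fun i _ => mul_comm _ _
    have e1 := hsc ((logFDeriv M f (φ p)).comp L)
    rw [ContinuousLinearMap.comp_apply] at e1
    rw [e1, hsc (chartFDeriv ρ x u)]
    simp only [Finset.mul_sum, ← Finset.sum_add_distrib]
    refine Finset.sum_congr rfl fun i _ => ?_
    simp [chartField]
    ring
  have hcf : chartField φ N x u = chartVol φ N x u • P (inChart φ x u) := hcr
  rw [hcd, hsum, hcf, map_smul, map_smul, map_smul, hVP, hlog, habs, ← hsd]
  change _ = σ * chartVol φ N x u * (f (φ p) * (ρ p * (n + k + meanCurvature M f φ N p *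
    ⟪φ p, N p⟫) + manifoldFDeriv ρ p (V p)))
  change σ * (ρ p * f (φ p)) * ((n - ⟪φ p, N p⟫ * surfaceDiv φ N p) * chartVol φ N x u) +
    σ * (ρ p * (f (φ p) * (chartVol φ N x u • (k - ⟪φ p, N p⟫ * ⟪gradLog M f (φ p), N p⟫)))
      + f (φ p) * (chartVol φ N x u • manifoldFDeriv ρ p (V p))) = _
  rw [meanCurvature, smul_eq_mul, smul_eq_mul]
  ring

lemma volume_boundary_halfSpace : (volume : Measure (Coord n)) {u | u 0 = 0} = 0 := by
  have h := (𝓡∂ n).convex_range.addHaar_frontier (volume : Measure (Coord n))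
  rw [frontier_range_modelWithCornersEuclideanHalfSpace] at h
  simpa only [eq_comm] using h

omit [IsManifold (𝓡∂ n) ∞ S] in
lemma ae_target_pos (x : S) :
    ∀ᵐ u ∂(volume : Measure (Coord n)).restrict (extChartAt (𝓡∂ n) x).target,
      u ∈ (extChartAt (𝓡∂ n) x).target ∧ 0 < u 0 := by
  have h1 : ∀ᵐ u ∂(volume : Measure (Coord n)), u 0 ≠ 0 :=
    measure_eq_zero_iff_ae_notMem.1 volume_boundary_halfSpace
  filter_upwards [ae_restrict_mem (measurableSet_target x), ae_restrict_of_ae h1] with u hu hu0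
  have h2 := extChartAt_target_subset_range x hu
  rw [range_modelWithCornersEuclideanHalfSpace] at h2
  exact ⟨hu, lt_of_le_of_ne h2 (Ne.symm hu0)⟩

variable [CompactSpace S] [T2Space S] [MeasurableSpace S] [BorelSpace S]

omit [IsManifold (𝓡∂ n) ∞ S] [CompactSpace S] [T2Space S] [MeasurableSpace S] [BorelSpace S] in
lemma continuous_density (hf : IsHomogeneousDensity M k f) (hφ : IsSmoothImmersion φ)
    (hφM : ∀ p, φ p ∈ punctured M) : Continuous fun p => f (φ p) :=
  hf.smooth.continuousOn.comp_continuous hφ.1.continuous hφM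

-- The integral identity for a cutoff supported in one chart: the test field has compact support and
-- no flux through the boundary face. Its divergence is known only at interior points, but the face
-- is a null set.
omit [T2Space S] in
lemma integral_weightedDiv_of_chart (hM : IsSolidCone M) (hf : IsHomogeneousDensity M k f)
    (hφ : IsSmoothImmersion φ)
    (hφM : ∀ p, φ p ∈ punctured M) (hN : IsUnitNormal φ N)
    (hbd : ∀ p ∈ (𝓡∂ n).boundary S, φ p ∈ frontier M)
    (horth : ∀ p ∈ (𝓡∂ n).boundary S, ∀ ξ ∈ normalSpace (frontier M) (φ p), ⟪N p, ξ⟫ = 0)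
    {V : S → Coord n}
    (hV : ∀ p, manifoldFDeriv φ p (V p) = φ p - ⟪φ p, N p⟫ • N p) {ρ : S → ℝ}
    (hρ : ContMDiff (𝓡∂ n) 𝓘(ℝ, ℝ) ∞ ρ) {x : S}
    (hρx : tsupport ρ ⊆ (extChartAt (𝓡∂ n) x).source) :
    Integrable (weightedDiv M k f φ N V ρ) (weightedAreaMeasure f φ) ∧
      ∫ p, weightedDiv M k f φ N V ρ p ∂(weightedAreaMeasure f φ) = 0 := by
  have hflux : ∀ u : Coord n, u 0 = 0 → testField f φ N ρ x u 0 = 0 := by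
    intro u hu0
    by_cases hu : u ∈ (extChartAt (𝓡∂ n) x).target
    · obtain ⟨P, hP⟩ := exists_tangential_leftInverse (chartFDeriv_injective hφ hu)
        (hN.norm_eq_one _) (inner_chartFDeriv_normal hφ hN hu)
      have h1 := tangential_position_boundary hM hφ hφM hbd horth hu hu0 hP
      have h2 : chartField φ N x u = _ := cramerField_eq hP (inChart φ x u)
      rw [testField, if_pos hu, h2]
      simp [h1]
    · rw [testField, if_neg hu]; rfl
  have hK := isCompact_chart_tsupport hρx
  obtain ⟨hint, hzero⟩ := integral_coordDiv_eq_zero (testField_contDiffOn hf hφ hφM hN hρ hρx)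
    hK (fun u _ hu => testField_eq_zero hu) hflux
  have hsub : (extChartAt (𝓡∂ n) x).target ⊆ range (𝓡∂ n) := extChartAt_target_subset_range x
  have hcongr : coordDiv (testField f φ N ρ x) =ᵐ[volume.restrict (extChartAt (𝓡∂ n) x).target]
      fun u => chartAreaDensity φ x u *
        (f (inChart φ x u) * inChart (weightedDiv M k f φ N V ρ) x u) := by
    filter_upwards [ae_target_pos x] with u hu
    exact coordDiv_testField hM hf hφ hφM hN hV hρ hu.1 hu.2
  have hsupp : ∀ p ∉ (extChartAt (𝓡∂ n) x).source, weightedDiv M k f φ N V ρ p = 0 := by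
    intro p hp
    have hp' : p ∉ tsupport ρ := fun h => hp (hρx h)
    have h1 : ρ =ᶠ[nhds p] fun _ => (0 : ℝ) := notMem_tsupport_iff_eventuallyEq.1 hp'
    have h2 : manifoldFDeriv (n := n) ρ p = 0 := by
      rw [manifoldFDeriv, h1.mfderiv_eq]
      exact mfderiv_const
    rw [weightedDiv, h2, h1.self_of_nhds]
    simp
  have h := integral_weightedAreaMeasure_of_chart hφ.1 (continuous_density hf hφ hφM)
    (fun p => hf.pos _ (hφM p)) x hsupp
    ((hint.mono_set hsub).congr hcongr)
  refine ⟨h.1, ?_⟩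
  rw [h.2, ← integral_congr_ae hcongr, ← hzero]
  refine (setIntegral_eq_of_subset_of_forall_sdiff_eq_zero measurableSet_halfSpace hsub ?_).symm
  intro u hu
  refine coordDiv_eq_zero hK (fun u _ hu => testField_eq_zero hu) hu.1 ?_
  rintro ⟨p, hp, rfl⟩
  exact hu.2 ((extChartAt (𝓡∂ n) x).map_source (hρx hp))

/-- The Minkowski formula. -/
theorem integral_minkowski (hM : IsSolidCone M) (hf : IsHomogeneousDensity M k f)
    (hφ : IsSmoothImmersion φ)
    (hφM : ∀ p, φ p ∈ punctured M) (hN : IsUnitNormal φ N)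
    (hbd : ∀ p ∈ (𝓡∂ n).boundary S, φ p ∈ frontier M)
    (horth : ∀ p ∈ (𝓡∂ n).boundary S, ∀ ξ ∈ normalSpace (frontier M) (φ p), ⟪N p, ξ⟫ = 0) :
    Integrable (fun p => (n : ℝ) + k + meanCurvature M f φ N p * ⟪φ p, N p⟫)
        (weightedAreaMeasure f φ) ∧
      ∫ p, ((n : ℝ) + k + meanCurvature M f φ N p * ⟪φ p, N p⟫) ∂(weightedAreaMeasure f φ) = 0 := by
  have hVex : ∀ p, ∃ v : Coord n, manifoldFDeriv φ p v = φ p - ⟪φ p, N p⟫ • N p := fun p => by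
    obtain ⟨P, hP⟩ := exists_tangential_leftInverse (L := manifoldFDeriv φ p) (hφ.2 p)
      (hN.norm_eq_one p) (inner_manifoldFDeriv_normal hN p)
    exact ⟨P (φ p), hP _⟩
  -- No regularity of `V` is needed: it only names the vector to which dρ is applied.
  choose V hV using hVex
  obtain ⟨t, -, ht⟩ := isCompact_univ.elim_nhds_subcover'
    (fun (y : S) _ => (extChartAt (𝓡∂ n) y).source)
    (fun y _ => extChartAt_source_mem_nhds (I := 𝓡∂ n) y)
    |>.imp fun t h => (⟨trivial, h⟩ : True ∧ _)
  let c : Fin t.card → S := fun i => (t.equivFin.symm i).1.1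
  have hcov : (univ : Set S) ⊆ ⋃ i, (extChartAt (𝓡∂ n) (c i)).source := by
    intro p hp
    obtain ⟨i, hi, hpi⟩ := mem_iUnion₂.1 (ht hp)
    exact mem_iUnion.2 ⟨t.equivFin ⟨i, hi⟩, by simpa [c] using hpi⟩
  obtain ⟨ρ, hρ⟩ := SmoothPartitionOfUnity.exists_isSubordinate (𝓡∂ n) isClosed_univ
    (fun i => (extChartAt (𝓡∂ n) (c i)).source) (fun i => isOpen_extChartAt_source _) hcov
  have hall := fun i => integral_weightedDiv_of_chart hM hf hφ hφM hN hbd horth hV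
    (ρ i).contMDiff (hρ i)
  have hone : ∀ p, ∑ i, ρ i p = 1 := fun p => by
    rw [← ρ.sum_eq_one (mem_univ p), finsum_eq_sum_of_fintype]
  have hsum : ∀ p, ∑ i, weightedDiv M k f φ N V (ρ i) p
      = (n : ℝ) + k + meanCurvature M f φ N p * ⟪φ p, N p⟫ := by
    intro p
    let g' : Fin t.card → TangentSpace (𝓡∂ n) p →L[ℝ] ℝ := fun i => mfderiv (𝓡∂ n) 𝓘(ℝ, ℝ) (ρ i) p
    have hmf : ∀ i, HasMFDerivAt (𝓡∂ n) 𝓘(ℝ, ℝ) (ρ i) p (g' i) := fun i =>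
      ((ρ i).contMDiff.mdifferentiable (by simp) p).hasMFDerivAt
    -- The cutoff terms cancel because the functions `ρ i` sum to the constant 1.
    have hd : ∑ i, manifoldFDeriv (ρ i) p (V p) = 0 := by
      have h1 : HasMFDerivAt (𝓡∂ n) 𝓘(ℝ, ℝ) (∑ i, (ρ i : S → ℝ)) p (∑ i, g' i) := by
        apply HasMFDerivAt.sum
        exact fun i _ => hmf i
      have h2 : (∑ i, (ρ i : S → ℝ)) = fun _ => (1 : ℝ) := by
        ext1 p
        rw [Finset.sum_apply, hone]
      have h3 : HasMFDerivAt (𝓡∂ n) 𝓘(ℝ, ℝ) (fun _ : S => (1 : ℝ)) p (∑ i, g' i) := by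
        rw [← h2]; exact h1
      have h4 := hasMFDerivAt_unique h3 (hasMFDerivAt_const (1 : ℝ) p)
      have h5 := congrArg (fun T : Coord n →L[ℝ] ℝ => T (V p)) h4
      have h6 : (∑ i, manifoldFDeriv (ρ i) p : Coord n →L[ℝ] ℝ) (V p) = 0 := h5
      simpa using h6
    simp only [weightedDiv, Finset.sum_add_distrib, ← Finset.sum_mul, hone, hd]
    ring
  refine ⟨?_, ?_⟩
  · have h := integrable_finsetSum Finset.univ fun i _ => (hall i).1
    simpa only [hsum] using h
  · have h := integral_finsetSum Finset.univ fun i (_ : i ∈ Finset.univ) => (hall i).1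
    simp only [hsum] at h
    rw [h]
    exact Finset.sum_eq_zero fun i _ => (hall i).2

end Minkowski

/-! ### The contact set with the boundary of the cone -/

section DensityPoints

variable {n : ℕ} [NeZero n]

/-- The derivative of a function vanishes at almost every point of its zero set. -/
lemma ae_fderiv_eq_zero {s : Set (Coord n)} (hs : MeasurableSet s) {h : Coord n → ℝ}
    {h' : Coord n → Coord n →L[ℝ] ℝ} (h0 : ∀ᵐ u ∂volume.restrict s, h u = 0)
    (hd : ∀ u ∈ s, HasFDerivAt h (h' u) u) : ∀ᵐ u ∂volume.restrict s, h' u = 0 := by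
  have h1 : ∀ᵐ u ∂(volume : Measure (Coord n)), u ∈ s → h u = 0 := (ae_restrict_iff' hs).1 h0
  set Z := toMeasurable volume {u | ¬ (u ∈ s → h u = 0)} with hZ
  have hZ0 : (volume : Measure (Coord n)) Z = 0 := by
    rw [hZ, measure_toMeasurable]; exact h1
  have hZm : MeasurableSet Z := measurableSet_toMeasurable _ _
  have hzero : ∀ u ∈ s \ Z, h u = 0 := fun u hu => by
    by_contra hc
    exact hu.2 (subset_toMeasurable _ _ (fun h2 => hc (h2 hu.1)))
  -- The estimate `norm_fderiv_sub_le` concerns maps from the space to itself, so `h` is multiplied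
  -- by a fixed nonzero vector. On its zero set it is approximated by the zero map with constant 0,
  -- which forces the derivative to vanish almost everywhere there.
  let e : Coord n := coordVec 0
  have he : e ≠ 0 := fun h => by
    have := congrArg (fun v : Coord n => v 0) h
    simp [e] at this
  have happ : ApproximatesLinearOn (fun u => h u • e) (0 : Coord n →L[ℝ] Coord n) (s \ Z) 0 := by
    intro u hu v hv
    simp [hzero u hu, hzero v hv]
  have h2 := happ.norm_fderiv_sub_le volume (hs.diff hZm) (fun u => (h' u).smulRight e)
    (fun u hu => ((hd u hu.1).smul_const e).hasFDerivWithinAt)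
  rw [ae_restrict_iff' (hs.diff hZm)] at h2
  rw [ae_restrict_iff' hs]
  filter_upwards [h2, measure_eq_zero_iff_ae_notMem.1 hZ0] with u hu huZ hus
  have h3 := hu ⟨hus, huZ⟩
  simp only [sub_zero, nonpos_iff_eq_zero, nnnorm_eq_zero] at h3
  ext v
  have h4 := congrArg (fun T : Coord n →L[ℝ] Coord n => T v) h3
  simpa [he] using h4

lemma ae_fderiv_eq_zero_vector {s : Set (Coord n)} (hs : MeasurableSet s) {h : Coord n → E n}
    {h' : Coord n → Coord n →L[ℝ] E n} (h0 : ∀ᵐ u ∂volume.restrict s, h u = 0)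
    (hd : ∀ u ∈ s, HasFDerivAt h (h' u) u) : ∀ᵐ u ∂volume.restrict s, h' u = 0 := by
  have h1 : ∀ i, ∀ᵐ u ∂volume.restrict s,
      (EuclideanSpace.proj i : E n →L[ℝ] ℝ).comp (h' u) = 0 := fun i =>
    ae_fderiv_eq_zero hs (h := fun u => (EuclideanSpace.proj i : E n →L[ℝ] ℝ) (h u))
      (h0.mono fun u hu => by rw [hu, map_zero])
      (fun u hu => (EuclideanSpace.proj i : E n →L[ℝ] ℝ).hasFDerivAt.comp u (hd u hu))
  filter_upwards [ae_all_iff.2 h1] with u hu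
  ext v i
  exact congrArg (fun T : Coord n →L[ℝ] ℝ => T v) (hu i)

end DensityPoints

/-! ### Unit normal and weighted curvature of the boundary of the cone -/

section UnitNormalOfCone

variable {n : ℕ} {M W : Set (E n)} {G : E n → ℝ}

/-- The vector that represents a linear form. -/
def dualVec {n : ℕ} : (E n →L[ℝ] ℝ) →L[ℝ] E n :=
  LinearMap.toContinuousLinearMap
    { toFun := fun D => WithLp.toLp 2 fun i => D (EuclideanSpace.single i 1)
      map_add' := fun _ _ => rfl
      map_smul' := fun _ _ => rfl }

lemma inner_dualVec (D : E n →L[ℝ] ℝ) (v : E n) : ⟪dualVec D, v⟫ = D v := by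
  conv_rhs => rw [← sum_smul_coordVec (n := n + 1) v]
  have h : ∀ i, dualVec D i = D (coordVec i) := fun i => rfl
  simp [PiLp.inner_apply, h]

/-- The unit normal field of the boundary of the cone, extended by a defining function. -/
def unitGrad (G : E n → ℝ) (y : E n) : E n :=
  ‖dualVec (fderiv ℝ G y)‖⁻¹ • dualVec (fderiv ℝ G y)

lemma IsDefiningFunction.dualVec_ne (hG : IsDefiningFunction M W G) {y : E n} (hy : y ∈ W) :
    dualVec (fderiv ℝ G y) ≠ 0 := fun h => hG.fderiv_ne y hy (ContinuousLinearMap.ext fun v => by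
  rw [← inner_dualVec, h, inner_zero_left]; rfl)

lemma IsDefiningFunction.norm_unitGrad (hG : IsDefiningFunction M W G) {y : E n} (hy : y ∈ W) :
    ‖unitGrad G y‖ = 1 := by
  rw [unitGrad, norm_smul, norm_inv, norm_norm,
    inv_mul_cancel₀ (norm_ne_zero_iff.2 (hG.dualVec_ne hy))]

lemma inner_unitGrad (y v : E n) :
    ⟪unitGrad G y, v⟫ = ‖dualVec (fderiv ℝ G y)‖⁻¹ * fderiv ℝ G y v := by
  rw [unitGrad, real_inner_smul_left, inner_dualVec]

lemma IsDefiningFunction.unitGrad_contDiffOn (hG : IsDefiningFunction M W G) :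
    ContDiffOn ℝ ∞ (unitGrad G) W := by
  have h1 : ContDiffOn ℝ ∞ (fun y => dualVec (fderiv ℝ G y)) W :=
    dualVec.contDiff.comp_contDiffOn (hG.smooth.fderiv_of_isOpen hG.isOpen (by simp))
  exact ((h1.norm ℝ fun y hy => hG.dualVec_ne hy).inv
    fun y hy => norm_ne_zero_iff.2 (hG.dualVec_ne hy)).smul h1

lemma IsDefiningFunction.unitGrad_hasFDerivAt (hG : IsDefiningFunction M W G) {y : E n}
    (hy : y ∈ W) : HasFDerivAt (unitGrad G) (fderiv ℝ (unitGrad G) y) y :=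
  ((hG.unitGrad_contDiffOn.differentiableOn (by simp)).differentiableAt
    (hG.isOpen.mem_nhds hy)).hasFDerivAt

lemma IsDefiningFunction.unitGrad_smul (hG : IsDefiningFunction M W G) {y : E n} (hy : y ∈ W)
    {t : ℝ} (ht : 0 < t) : unitGrad G (t • y) = unitGrad G y := by
  rw [unitGrad, fderiv_smul_of_homogeneous hG.isOpen hG.smul_mem
    (hG.smooth.differentiableOn (by simp)) hG.homogeneous hy ht, map_smul, norm_smul, norm_inv,
    Real.norm_of_nonneg ht.le, smul_smul, unitGrad]
  congr 1
  field_simp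

lemma IsDefiningFunction.inner_fderiv_unitGrad (hG : IsDefiningFunction M W G) {y : E n}
    (hy : y ∈ W) (v : E n) : ⟪unitGrad G y, fderiv ℝ (unitGrad G) y v⟫ = 0 := by
  have h := hG.unitGrad_hasFDerivAt hy
  have h1 := h.inner ℝ h
  have h2 : HasFDerivAt (fun z => ⟪unitGrad G z, unitGrad G z⟫) (0 : E n →L[ℝ] ℝ) y := by
    refine (hasFDerivAt_const (1 : ℝ) y).congr_of_eventuallyEq ?_
    filter_upwards [hG.isOpen.mem_nhds hy] with z hz
    rw [real_inner_self_eq_norm_sq, hG.norm_unitGrad hz, one_pow]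
  have h4 := congrArg (fun T : E n →L[ℝ] ℝ => T v) (h1.unique h2)
  simpa [real_inner_comm] using h4

variable {k : ℝ} {f : E n → ℝ}

/-- The weighted mean curvature of the level sets of a defining function, up to sign. -/
def levelCurvature (M : Set (E n)) (f G : E n → ℝ) (y : E n) : ℝ :=
  LinearMap.trace ℝ (E n) (fderiv ℝ (unitGrad G) y : E n →L[ℝ] E n) +
    logFDeriv M f y (unitGrad G y)

/-- The unit normal is homogeneous of degree 0, so its derivative has degree -1, as does the
differential of log f. -/
lemma IsDefiningFunction.levelCurvature_smul (hM : IsSolidCone M)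
    (hf : IsHomogeneousDensity M k f) (hG : IsDefiningFunction M W G) {y : E n} (hy : y ∈ W)
    (hyM : y ∈ punctured M) {t : ℝ} (ht : 0 < t) :
    levelCurvature M f G (t • y) = t⁻¹ * levelCurvature M f G y := by
  rw [levelCurvature, fderiv_smul_of_homogeneous hG.isOpen hG.smul_mem
    (hG.unitGrad_contDiffOn.differentiableOn (by simp))
    (fun y hy t ht => hG.unitGrad_smul hy ht) hy ht, logFDeriv_smul hM hf hyM ht,
    hG.unitGrad_smul hy ht, levelCurvature, mul_add]
  congr 1
  rw [ContinuousLinearMap.toLinearMap_smul, map_smul, smul_eq_mul]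

lemma IsDefiningFunction.levelCurvature_hasFDerivWithinAt (hM : IsSolidCone M)
    (hf : IsHomogeneousDensity M k f) (hG : IsDefiningFunction M W G) {y : E n} (hy : y ∈ W)
    (hyM : y ∈ punctured M) :
    HasFDerivWithinAt (levelCurvature M f G)
      (fderivWithin ℝ (levelCurvature M f G) (punctured M) y) (punctured M) y := by
  have h1 : DifferentiableAt ℝ (fderiv ℝ (unitGrad G)) y :=
    ((hG.unitGrad_contDiffOn.fderiv_of_isOpen hG.isOpen (m := ∞) (by simp)).differentiableOn
      (by simp)).differentiableAt (hG.isOpen.mem_nhds hy)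
  let tr : (E n →L[ℝ] E n) →L[ℝ] ℝ := LinearMap.toContinuousLinearMap
    ((LinearMap.trace ℝ (E n)).comp (ContinuousLinearMap.coeLM ℝ))
  have h2 : DifferentiableAt ℝ (fun y => tr (fderiv ℝ (unitGrad G) y)) y :=
    tr.differentiableAt.comp y h1
  have h3 : DifferentiableWithinAt ℝ (fun y => logFDeriv M f y (unitGrad G y)) (punctured M) y :=
    ((logFDeriv_contDiffOn hM hf).differentiableOn (by simp) y hyM).clm_apply
      (hG.unitGrad_hasFDerivAt hy).differentiableAt.differentiableWithinAt
  exact (h2.differentiableWithinAt.add h3).hasFDerivWithinAt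

lemma IsDefiningFunction.levelCurvature_radial (hM : IsSolidCone M)
    (hf : IsHomogeneousDensity M k f) (hG : IsDefiningFunction M W G) {y : E n} (hy : y ∈ W)
    (hyM : y ∈ punctured M) :
    fderivWithin ℝ (levelCurvature M f G) (punctured M) y y = - levelCurvature M f G y := by
  refine radial_derivative hM hyM (hG.levelCurvature_hasFDerivWithinAt hM hf hy hyM)
    (c := fun t => t⁻¹ * levelCurvature M f G y)
    (fun t ht => hG.levelCurvature_smul hM hf hy hyM ht) ?_
  simpa using (hasDerivAt_inv (one_ne_zero (α := ℝ))).mul_const (levelCurvature M f G y)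

/-- A unit vector orthogonal to a hyperplane is a unit normal up to sign. -/
lemma eq_inner_smul_of_orthogonal {L : Coord n →L[ℝ] E n} {ν η : E n} {P : E n →L[ℝ] Coord n}
    (hν : ‖ν‖ = 1) (hη : ‖η‖ = 1) (hP : ∀ y, L (P y) = y - ⟪y, ν⟫ • ν)
    (hηL : ∀ v, ⟪η, L v⟫ = 0) : ⟪ν, η⟫ • ν = η ∧ ⟪ν, η⟫ * ⟪ν, η⟫ = 1 := by
  have h1 := hηL (P η)
  have hηη : ⟪η, η⟫ = 1 := by rw [real_inner_self_eq_norm_sq, hη, one_pow]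
  have hνν : ⟪ν, ν⟫ = 1 := by rw [real_inner_self_eq_norm_sq, hν, one_pow]
  have hc : ⟪η, ν⟫ = ⟪ν, η⟫ := real_inner_comm _ _
  rw [hP, inner_sub_right, real_inner_smul_right, hηη, hc] at h1
  have h2 : ⟪ν, η⟫ * ⟪ν, η⟫ = 1 := by linarith
  refine ⟨?_, h2⟩
  rw [← sub_eq_zero, ← inner_self_eq_zero (𝕜 := ℝ), inner_sub_left, inner_sub_right,
    inner_sub_right, real_inner_smul_left, real_inner_smul_left, real_inner_smul_right,
    real_inner_smul_right, hνν, hηη, hc]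
  linarith

end UnitNormalOfCone

/-! ### The contact set is null when the curvature is a nonzero constant -/

section Contact

variable {n : ℕ} [NeZero n] {S : Type*} [TopologicalSpace S]
  [ChartedSpace (EuclideanHalfSpace n) S] [IsManifold (𝓡∂ n) ∞ S] {φ N : S → E n}
  {M W : Set (E n)} {k : ℝ} {f G : E n → ℝ} [MeasurableSpace S] [BorelSpace S]

/-- The interior points of the chart at `x` that touch the boundary of the cone in `W`. -/
def contactSet (M W : Set (E n)) (φ : S → E n) (x : S) : Set (Coord n) :=
  chartPreimage x (φ ⁻¹' (frontier M ∩ W)) ∩ {u | 0 < u 0}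

omit [IsManifold (𝓡∂ n) ∞ S] in
lemma measurableSet_contactSet (hφ : IsSmoothImmersion φ) (hW : IsOpen W) (x : S) :
    MeasurableSet (contactSet M W φ x) :=
  (measurableSet_chartPreimage x ((isClosed_frontier.measurableSet.inter hW.measurableSet).preimage
    hφ.1.continuous.measurable)).inter
    (isOpen_lt continuous_const (by fun_prop)).measurableSet

/-- Three successive differentiations on the contact set, each valid almost everywhere, match first
the normals, then the shape operators, and finally force the curvature of ∂M to vanish. -/
lemma volume_contactSet (hM : IsSolidCone M) (hf : IsHomogeneousDensity M k f)
    (hφ : IsSmoothImmersion φ) (hφM : ∀ p, φ p ∈ punctured M) (hN : IsUnitNormal φ N)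
    {H : ℝ} (hH : ∀ p, meanCurvature M f φ N p = H) (hH0 : H ≠ 0)
    (hG : IsDefiningFunction M W G) (x : S) :
    (volume : Measure (Coord n)) (contactSet M W φ x) = 0 := by
  set s := contactSet M W φ x
  have hs : MeasurableSet s := measurableSet_contactSet hφ hG.isOpen x
  have htar : ∀ u ∈ s, u ∈ (extChartAt (𝓡∂ n) x).target := fun u hu => hu.1.2
  have hW : ∀ u ∈ s, inChart φ x u ∈ W := fun u hu => hu.1.1.2
  have hΦ : ∀ u ∈ s, HasFDerivAt (inChart φ x) (chartFDeriv φ x u) u := fun u hu =>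
    (inChart_hasFDerivWithinAt hφ.1 (htar u hu)).hasFDerivAt (halfSpace_mem_nhds hu.2)
  have hν : ∀ u ∈ s, HasFDerivAt (inChart N x) (chartFDeriv N x u) u := fun u hu =>
    (inChart_hasFDerivWithinAt hN.smooth (htar u hu)).hasFDerivAt (halfSpace_mem_nhds hu.2)
  let η : Coord n → E n := fun u => unitGrad G (inChart φ x u)
  let η' : Coord n → E n →L[ℝ] E n := fun u => fderiv ℝ (unitGrad G) (inChart φ x u)
  have hη : ∀ u ∈ s, HasFDerivAt η ((η' u).comp (chartFDeriv φ x u)) u := fun u hu =>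
    (hG.unitGrad_hasFDerivAt (hW u hu)).comp u (hΦ u hu)
  have hPex : ∀ u ∈ s, ∃ P : E n →L[ℝ] Coord n,
      ∀ y, chartFDeriv φ x u (P y) = y - ⟪y, inChart N x u⟫ • inChart N x u := fun u hu =>
    exists_tangential_leftInverse (chartFDeriv_injective hφ (htar u hu)) (hN.norm_eq_one _)
      (inner_chartFDeriv_normal hφ hN (htar u hu))
  have hN1 : ∀ u : Coord n, ‖inChart N x u‖ = 1 := fun u => hN.norm_eq_one _
  -- the normals agree up to sign
  have step1 : ∀ᵐ u ∂volume.restrict s, ∀ v, ⟪η u, chartFDeriv φ x u v⟫ = 0 := by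
    have h := ae_fderiv_eq_zero hs (h := fun u => G (inChart φ x u))
      ((ae_restrict_mem hs).mono fun u hu => hG.frontier _ (hW u hu) hu.1.1.1)
      (fun u hu => (hG.differentiableAt (hW u hu)).comp u (hΦ u hu))
    filter_upwards [h] with u hu v
    have h2 : fderiv ℝ G (inChart φ x u) (chartFDeriv φ x u v) = 0 :=
      congrArg (fun T : Coord n →L[ℝ] ℝ => T v) hu
    simp only [η]
    rw [inner_unitGrad, h2, mul_zero]
  have step1' : ∀ᵐ u ∂volume.restrict s,
      ⟪inChart N x u, η u⟫ • inChart N x u = η u ∧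
        ⟪inChart N x u, η u⟫ * ⟪inChart N x u, η u⟫ = 1 := by
    filter_upwards [step1, ae_restrict_mem hs] with u hu hus
    obtain ⟨P, hP⟩ := hPex u hus
    exact eq_inner_smul_of_orthogonal (hN1 u) (hG.norm_unitGrad (hW u hus)) hP hu
  -- at contact points the function `⟪N, η⟫` is stationary
  have hstat : ∀ u ∈ s, ⟪inChart N x u, η u⟫ • inChart N x u = η u →
      ⟪inChart N x u, η u⟫ * ⟪inChart N x u, η u⟫ = 1 → ∀ v : Coord n,
      ⟪inChart N x u, η' u (chartFDeriv φ x u v)⟫ + ⟪chartFDeriv N x u v, η u⟫ = 0 := by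
    intro u hu h1 h2 v
    have e1 : ⟪chartFDeriv N x u v, inChart N x u⟫ = 0 :=
      inner_chartFDeriv_normal_self hN (htar u hu) v
    have e2 := hG.inner_fderiv_unitGrad (hW u hu) (chartFDeriv φ x u v)
    have e3 : ⟪chartFDeriv N x u v, η u⟫ = 0 := by
      rw [← h1, real_inner_smul_right, e1, mul_zero]
    have e4 : ⟪inChart N x u, η u⟫ * ⟪inChart N x u, η' u (chartFDeriv φ x u v)⟫ = 0 := by
      rw [← real_inner_smul_left, h1]; exact e2
    have e5 : ⟪inChart N x u, η u⟫ ≠ 0 := fun h => by rw [h] at h2; norm_num at h2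
    rw [e3, (mul_eq_zero.1 e4).resolve_left e5, add_zero]
  have hin : ∀ u ∈ s, HasFDerivAt (fun u => ⟪inChart N x u, η u⟫) _ u := fun u hu =>
    (hν u hu).inner ℝ (hη u hu)
  -- the shape operators agree up to sign
  have step2 : ∀ᵐ u ∂volume.restrict s, ∀ v,
      ⟪inChart N x u, η u⟫ • chartFDeriv N x u v = η' u (chartFDeriv φ x u v) := by
    have h := ae_fderiv_eq_zero_vector hs
      (h := fun u => ⟪inChart N x u, η u⟫ • inChart N x u - η u)
      (step1'.mono fun u hu => sub_eq_zero.2 hu.1)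
      (fun u hu => ((hin u hu).smul (hν u hu)).sub (hη u hu))
    filter_upwards [h, step1', ae_restrict_mem hs] with u hu h1 hus v
    have h2 := congrArg (fun T : Coord n →L[ℝ] E n => T v) hu
    have h3 := hstat u hus h1.1 h1.2 v
    simp [h3] at h2
    exact sub_eq_zero.1 h2
  -- Taking traces in `step2`: the ambient trace of the derivative of `η` is tangential because its
  -- normal entry vanishes, so the level curvature is -H times the sign ⟨N,η⟩.
  have step2' : ∀ᵐ u ∂volume.restrict s,
      levelCurvature M f G (inChart φ x u) + ⟪inChart N x u, η u⟫ * H = 0 := by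
    filter_upwards [step1', step2, ae_restrict_mem hs] with u h1 h2 hus
    obtain ⟨P, hP⟩ := hPex u hus
    have hsd := surfaceDiv_eq_gramDiv hφ hN (htar u hus)
    rw [gramDiv_eq_trace (chartFDeriv_injective hφ (htar u hus)) hP
      (inner_chartFDeriv_normal_self hN (htar u hus))] at hsd
    have hNN : ⟪η' u (inChart N x u), inChart N x u⟫ = 0 := by
      have e2 := hG.inner_fderiv_unitGrad (hW u hus) (inChart N x u)
      have e4 : ⟪inChart N x u, η u⟫ * ⟪inChart N x u, η' u (inChart N x u)⟫ = 0 := by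
        rw [← real_inner_smul_left, h1.1]; exact e2
      have e5 : ⟪inChart N x u, η u⟫ ≠ 0 := fun h => by
        have := h1.2
        rw [h] at this; norm_num at this
      rw [real_inner_comm]
      exact (mul_eq_zero.1 e4).resolve_left e5
    have htr := trace_eq_trace_tangential hP (η' u) hNN
    have hcomp : P.comp ((η' u).comp (chartFDeriv φ x u))
        = ⟪inChart N x u, η u⟫ • P.comp (chartFDeriv N x u) := by
      ext1 v
      simp [← h2 v]
    rw [hcomp, ContinuousLinearMap.toLinearMap_smul, map_smul, smul_eq_mul, ← hsd] at htr
    have hHu := hH ((extChartAt (𝓡∂ n) x).symm u)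
    rw [meanCurvature, inner_gradLog] at hHu
    have hlog : logFDeriv M f (inChart φ x u) (η u)
        = ⟪inChart N x u, η u⟫ * logFDeriv M f (inChart φ x u) (inChart N x u) := by
      rw [← smul_eq_mul, ← map_smul, h1.1]
    change LinearMap.trace ℝ (E n) (η' u : E n →L[ℝ] E n) + logFDeriv M f (inChart φ x u) (η u)
      + _ = 0
    rw [← htr, hlog, ← hHu]
    change _ + ⟪inChart N x u, η u⟫ * logFDeriv M f (φ ((extChartAt (𝓡∂ n) x).symm u))
      (N ((extChartAt (𝓡∂ n) x).symm u)) + _ = 0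
    ring
  -- Here X is tangent to Σ, being orthogonal to `η`, hence to N. Differentiating `step2'` along X,
  -- with ⟨N,η⟩ stationary, and using homogeneity of degree -1 gives zero level curvature, hence H =
  -- 0.
  have step3 : ∀ᵐ u ∂volume.restrict s, False := by
    have h := ae_fderiv_eq_zero hs step2' (fun u hu =>
      (hasFDerivWithinAt_univ.1 ((hG.levelCurvature_hasFDerivWithinAt hM hf (hW u hu)
        (hφM _)).comp u ((hΦ u hu).hasFDerivWithinAt (s := univ)) (fun v _ => hφM _))).add
        ((hin u hu).mul_const H))
    filter_upwards [h, step1', step2', ae_restrict_mem hs] with u hu h1 h2 hus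
    obtain ⟨P, hP⟩ := hPex u hus
    have hXη : fderiv ℝ G (inChart φ x u) (inChart φ x u) = 0 :=
      radial_derivative hM (hφM _) (hG.differentiableAt (hW u hus)).hasFDerivWithinAt
        (c := fun _ => G (inChart φ x u)) (fun t ht => hG.homogeneous _ (hW u hus) t ht)
        (hasDerivAt_const _ _)
    have e5 : ⟪inChart N x u, η u⟫ ≠ 0 := fun h => by
      have := h1.2
      rw [h] at this; norm_num at this
    have hXN : ⟪inChart φ x u, inChart N x u⟫ = 0 := by
      have e1 : ⟪η u, inChart φ x u⟫ = 0 := by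
        simp only [η]
        rw [inner_unitGrad, hXη, mul_zero]
      rw [← h1.1, real_inner_smul_left] at e1
      rw [real_inner_comm]
      exact (mul_eq_zero.1 e1).resolve_left e5
    have hLP : chartFDeriv φ x u (P (inChart φ x u)) = inChart φ x u := by
      rw [hP, hXN, zero_smul, sub_zero]
    have h3 := congrArg (fun T : Coord n →L[ℝ] ℝ => T (P (inChart φ x u))) hu
    have h4 := hstat u hus h1.1 h1.2 (P (inChart φ x u))
    have h5 := hG.levelCurvature_radial hM hf (hW u hus) (hφM _)
    simp [h4] at h3
    rw [hLP] at h3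
    have h6 : levelCurvature M f G (inChart φ x u) = 0 := by
      have h7 := h5.symm.trans h3
      linarith
    rw [h6, zero_add] at h2
    exact hH0 ((mul_eq_zero.1 h2).resolve_left e5)
  have := (ae_restrict_iff' hs).1 step3
  exact measure_eq_zero_iff_ae_notMem.2 this

variable [CompactSpace S]

/-- If the weighted mean curvature is a nonzero constant, the hypersurface touches the boundary of
the cone in a null set. -/
theorem area_contact_eq_zero (hM : IsSolidCone M) (hf : IsHomogeneousDensity M k f)
    (hφ : IsSmoothImmersion φ) (hφM : ∀ p, φ p ∈ punctured M) (hN : IsUnitNormal φ N)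
    {H : ℝ} (hH : ∀ p, meanCurvature M f φ N p = H) (hH0 : H ≠ 0) :
    area φ (φ ⁻¹' frontier M) = 0 := by
  refine area_eq_zero_of_chart hφ.1
    (isClosed_frontier.preimage hφ.1.continuous).measurableSet fun x => ?_
  have hsub : chartPreimage (n := n) x (φ ⁻¹' frontier M) ⊆
      (chartPreimage x (φ ⁻¹' frontier M) ∩ {u | 0 < u 0}) ∪ {u | u 0 = 0} := by
    intro u hu
    have h2 := extChartAt_target_subset_range x hu.2
    rw [range_modelWithCornersEuclideanHalfSpace] at h2
    rcases eq_or_lt_of_le (show 0 ≤ u 0 from h2) with h | h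
    · exact Or.inr h.symm
    · exact Or.inl ⟨hu, h⟩
  refine measure_mono_null hsub (measure_union_null ?_ volume_boundary_halfSpace)
  -- Defining functions exist only locally, so nullity is checked near each contact point.
  refine measure_null_of_locally_null _ fun u hu => ?_
  obtain ⟨W, G, hG, hqW⟩ := exists_definingFunction hM (hφM _) hu.1.1
  refine ⟨contactSet M W φ x, ?_, volume_contactSet hM hf hφ hφM hN hH hH0 hG x⟩
  have hc : ContinuousAt (inChart φ x) u :=
    (inChart_contDiffWithinAt hφ.1 hu.1.2).continuousWithinAt.continuousAt (halfSpace_mem_nhds hu.2)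
  filter_upwards [self_mem_nhdsWithin,
    mem_nhdsWithin_of_mem_nhds (hc.preimage_mem_nhds (hG.isOpen.mem_nhds hqW))] with v hv hvW
  exact ⟨⟨⟨hv.1.1, hvW⟩, hv.1.2⟩, hv.2⟩

end Contact

end SolidCone

end

/-! ### The integral formula and its consequence for constant curvature -/

theorem mainTheorem7 (n : ℕ) [NeZero n]
    -- a solid cone in `ℝⁿ⁺¹` with a homogeneous density of degree `k`
    (M : Set (SolidCone.E n)) (hM : SolidCone.IsSolidCone M)
    (k : ℝ) (f : SolidCone.E n → ℝ) (hf : SolidCone.IsHomogeneousDensity M k f)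
    -- a compact smooth manifold with boundary, immersed in the punctured cone, with unit normal `N`
    (S : Type*) [TopologicalSpace S] [T2Space S] [CompactSpace S]
    [ChartedSpace (EuclideanHalfSpace n) S] [IsManifold (𝓡∂ n) ∞ S]
    [MeasurableSpace S] [BorelSpace S]
    (φ : S → SolidCone.E n) (hφ : SolidCone.IsSmoothImmersion φ)
    (hφM : ∀ p : S, φ p ∈ SolidCone.punctured M)
    (N : S → SolidCone.E n) (hN : SolidCone.IsUnitNormal φ N)
    -- the boundary lies in `∂M`, where the hypersurface meets `∂M` orthogonally
    (hbd : ∀ p ∈ (𝓡∂ n).boundary S, φ p ∈ frontier M)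
    (horth : ∀ p ∈ (𝓡∂ n).boundary S,
      ∀ ξ ∈ SolidCone.normalSpace (frontier M) (φ p), ⟪N p, ξ⟫ = 0) :
    (IsFiniteMeasure (SolidCone.weightedAreaMeasure f φ) ∧
      Integrable
        (fun p => (n : ℝ) + k + SolidCone.meanCurvature M f φ N p * ⟪φ p, N p⟫)
        (SolidCone.weightedAreaMeasure f φ) ∧
      ∫ p, ((n : ℝ) + k + SolidCone.meanCurvature M f φ N p * ⟪φ p, N p⟫)
        ∂(SolidCone.weightedAreaMeasure f φ) = 0) ∧
    (k ≠ -((n : ℝ) + 1) → ∀ H : ℝ, (∀ p : S, SolidCone.meanCurvature M f φ N p = H) →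
      ((n : ℝ) + k) * SolidCone.weightedArea M f φ =
        ((n : ℝ) + k + 1) * H * SolidCone.orientedVolume k f φ N) := by
  open SolidCone in
  have hcont := continuous_density hf hφ hφM
  have hfin : IsFiniteMeasure (weightedAreaMeasure f φ) :=
    isFiniteMeasure_weightedAreaMeasure hφ.1 hcont
  have hmain := integral_minkowski hM hf hφ hφM hN hbd horth
  refine ⟨⟨hfin, hmain⟩, fun hk H hH => ?_⟩
  have hk' : (n : ℝ) + k + 1 ≠ 0 := fun h => hk (by linarith)
  obtain ⟨C, hC⟩ := (isCompact_range (hφ.1.continuous.norm)).bddAbove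
  have hXN : Integrable (fun p => ⟪φ p, N p⟫) (weightedAreaMeasure f φ) := by
    refine Integrable.of_bound
      ((hφ.1.continuous.inner hN.smooth.continuous).measurable.aestronglyMeasurable) C
      (Filter.Eventually.of_forall fun p => ?_)
    calc ‖⟪φ p, N p⟫‖ ≤ ‖φ p‖ * ‖N p‖ := norm_inner_le_norm _ _
      _ = ‖φ p‖ := by rw [hN.norm_eq_one, mul_one]
      _ ≤ C := hC (mem_range_self p)
  have hformula : ((n : ℝ) + k) * (weightedAreaMeasure f φ).real univ
      + H * ∫ p, ⟪φ p, N p⟫ ∂(weightedAreaMeasure f φ) = 0 := by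
    have h := hmain.2
    simp only [hH] at h
    rw [integral_add (integrable_const _) (hXN.const_mul H), integral_const, integral_const_mul,
      smul_eq_mul] at h
    linarith
  have harea : ((n : ℝ) + k) * weightedArea M f φ
      = ((n : ℝ) + k) * (weightedAreaMeasure f φ).real univ := by
    -- For H = 0 the contact set may have positive area, but then `hformula` says that n + k or the
    -- total weighted area is zero, and both sides vanish.
    by_cases hH0 : H = 0
    · rw [hH0, zero_mul, add_zero] at hformula
      rw [hformula]
      rcases mul_eq_zero.1 hformula with h | h
      · rw [h, zero_mul]
      · have h2 : weightedArea M f φ ≤ 0 := h ▸ measureReal_mono (subset_univ _)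
        rw [le_antisymm h2 measureReal_nonneg, mul_zero]
    · have hnull : weightedAreaMeasure f φ (φ ⁻¹' frontier M) = 0 :=
        withDensity_absolutelyContinuous _ _ (area_contact_eq_zero hM hf hφ hφM hN hH hH0)
      congr 1
      refine measureReal_congr (Filter.eventuallyEq_set.2 ?_)
      filter_upwards [measure_eq_zero_iff_ae_notMem.1 hnull] with p hp
      have hpi : φ p ∈ interior M := by
        by_contra hi
        exact hp ⟨subset_closure (hφM p).1, hi⟩
      simp only [mem_preimage, hpi, mem_univ]
  rw [harea, orientedVolume]
  field_simp
  linarith
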